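/- Let $m\ge 1$ be an integer and let $\mathcal W^{m,2}([0,1])$ be the space of functions $f:[0,1]\to\mathbb R$ with $m-1$ continuous derivatives, $f^{(m-1)}$ absolutely continuous and $\int_0^1\{f^{(m)}(x)\}^2dx<\infty$; for $\lambda>0$ put $\|f\|_{m,\lambda}^2=\|f\|_2^2+\lambda\|f^{(m)}\|_2^2$, where $\|\cdot\|_2$ is the norm of $L^2([0,1])$. For each $n\ge 1$ let $Y_i=f_o(t_{in})+\epsilon_i$, $i=1,\dots,n$, where $f_o\in\mathcal W^{m,2}([0,1])$, the design points $t_{in}\in[0,1]$ are non-random and $\epsilon_1,\epsilon_2,\dots$ are independent and identically distributed real random variables. Let $\widehat\sigma=\widehat\sigma_n$ be real random variables (scale estimates) and let $\sigma>0$. Assume: (C1) $\rho:\mathbb R\to\mathbb R$ is convex and differentiable, and its derivative $\psi$ is twice differentiable with bounded second derivative $\psi''$. (C2) $\mathbb E\{|\psi(\epsilon_1/\sigma)|^2\}<\infty$, $\mathbb E\{\psi(\epsilon_1/\sigma)\}=0$, $\mathbb E\{\psi'(\epsilon_1/\sigma)\}>0$, $\mathbb E\{|\psi'(\epsilon_1/\sigma)\epsilon_1|^2\}<\infty$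 and $\mathbb E\{\psi'(\epsilon_1/\sigma)\epsilon_1\}=0$. (C3) The design is quasi-uniform: there is a constant $K$ such that for all $n\ge 2$ and all $f\in\mathcal W^{1,2}([0,1])$, $$\left|\frac1n\sum_{i=1}^n f(t_{in})-\int_0^1 f(t)\,dt\right|\le\frac Kn\|f'\|_2 .$$ (C4) $\mathbb E\{|\epsilon_1|^2\}<\infty$. (C5) $n^{m/(2m+1)}(\widehat\sigma_n-\sigma)=O_P(1)$. Let $\lambda=\lambda_n>0$ be non-random with $\lambda_n\asymp n^{-\gamma}$ for some $\gamma\in(0,1)$. Then there exists a sequence of M-type smoothing splines with auxiliary scale, that is, of (random) functions $\widehat f_{n,\widehat\sigma}$ such that, for every $n\ge1$, whenever $\widehat\sigma_n>0$, $\widehat f_{n,\widehat\sigma}$ is a solution of $$\min_{f\in\mathcal W^{m,2}([0,1])}\left[\frac1n\sum_{i=1}^n\rho\left(\frac{Y_i-f(t_{in})}{\widehat\sigma_n}\right)+\lambda_n\int_0^1\{f^{(m)}(x)\}^2dx\right],$$ which satisfies $$\|\widehat f_{n,\widehat\sigma}-f_o\|_{m,\lambda_n}^2=O_P\left(\lambda_n+(n\lambda_n^{1/(2m)})^{-1}\right)\qquad(n\to\infty).$$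 -/

import Mathlib

open Set Filter Topology MeasureTheory ProbabilityTheory

noncomputable section

/-- `f^{(k)}` on `[0,1]`, with one-sided derivatives at the end points. -/
def derivUnit (k : ℕ) (f : ℝ → ℝ) : ℝ → ℝ :=
  iteratedDerivWithin k f (Icc (0 : ℝ) 1)

/-- The squared norm `‖f‖₂² = ∫₀¹ f²` of `L²([0,1])`. -/
def sqNormL2 (f : ℝ → ℝ) : ℝ :=
  ∫ x in (0 : ℝ)..1, f x ^ 2

/-- Membership (for `m ≥ 1`) in the Hilbert-Sobolev space `W^{m,2}([0,1])`: on `[0,1]` the function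
has continuous derivatives up to order `m - 1`, the last of which is absolutely continuous with an
(almost everywhere defined) derivative `f^{(m)}` in `L²([0,1])`. Only the values of `f` on `[0,1]`
matter. -/
structure MemSobolev (m : ℕ) (f : ℝ → ℝ) : Prop where
  contDiffOn : ContDiffOn ℝ ((m - 1 : ℕ) : ℕ∞) f (Icc (0 : ℝ) 1)
  absCont : AbsolutelyContinuousOnInterval (derivUnit (m - 1) f) 0 1
  memLp : MemLp (derivUnit m f) 2 (volume.restrict (Icc (0 : ℝ) 1))

/-- The squared norm `‖f‖²_{m,λ} = ‖f‖₂² + λ ‖f^{(m)}‖₂²`. -/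
def sqNormSobolev (m : ℕ) (lam : ℝ) (f : ℝ → ℝ) : ℝ :=
  sqNormL2 f + lam * sqNormL2 (derivUnit m f)

/-- Quasi-uniformity of a triangular array of design points `t n i`, `i < n`. -/
def QuasiUniformDesign (t : (n : ℕ) → Fin n → ℝ) : Prop :=
  ∃ K : ℝ, ∀ n : ℕ, 2 ≤ n → ∀ f : ℝ → ℝ, MemSobolev 1 f →
    |(1 / (n : ℝ)) * ∑ i : Fin n, f (t n i) - ∫ x in (0 : ℝ)..1, f x|
      ≤ K / (n : ℝ) * Real.sqrt (sqNormL2 (derivUnit 1 f))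

/-- The penalized objective function with loss `ρ`, scale `s` and smoothing parameter `lam`, for
responses `Y` observed at the points `t`. -/
def splineObjective (m : ℕ) (ρ : ℝ → ℝ) (lam s : ℝ) {n : ℕ} (t Y : Fin n → ℝ) (f : ℝ → ℝ) : ℝ :=
  (1 / (n : ℝ)) * ∑ i : Fin n, ρ ((Y i - f (t i)) / s) + lam * sqNormL2 (derivUnit m f)

/-- `f` is an M-type smoothing spline with scale `s`: a minimizer of the objective function over
`W^{m,2}([0,1])`. -/
def IsMTypeSpline (m : ℕ) (ρ : ℝ → ℝ) (lam s : ℝ) {n : ℕ} (t Y : Fin n → ℝ) (f : ℝ → ℝ) : Prop :=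
  MemSobolev m f ∧
    ∀ g : ℝ → ℝ, MemSobolev m g →
      splineObjective m ρ lam s t Y f ≤ splineObjective m ρ lam s t Y g

/-- `X n = O_P(a n)` as `n → ∞` under `μ` (outer probability for sets that are not measurable). -/
def IsBigOInProbability {Ω : Type*} [MeasurableSpace Ω] (μ : Measure Ω)
    (X : ℕ → Ω → ℝ) (a : ℕ → ℝ) : Prop :=
  ∀ δ : ℝ, 0 < δ → ∃ M : ℝ, ∀ᶠ n : ℕ in atTop,
    μ {ω | M * |a n| < |X n ω|} ≤ ENNReal.ofReal δ

end

noncomputable section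

/-! Put `h = λ^{1/(2m)}` (the bandwidth), `τ₀ = 1/σ`, `τ = 1/σ̂` and `R = λ + 1/(nh)`. The argument
shows that, with probability close to one, the objective at `f₀ + g` strictly exceeds its value at
`f₀` for every `g` with `‖g‖²_{m,λ} = D²R`. By convexity no minimizer can then lie outside that
sphere (`exists_isMTypeSpline_bound`).

On the sphere the increment is Taylor expanded in `g(tᵢ)` and in `τ - τ₀` (`mean_loss_sub_ge`). The
curvature `κ = E ψ'(ε/σ) > 0` and the penalty give a gain of order `D²R`. The linear terms have the
centred weights `ψ(τ₀ε)` and `ψ'(τ₀ε)ε`; together with the cross term of the penalty they cost only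
order `DR`. The part quadratic in `τ - τ₀` is also of that order, because `(τ - τ₀)² = O(n^{-1/2})`
and `sup|g|` is at most of order `h^{-1/2}` times the first order norm. All else is small against
`D²R`, since `h → 0` and `nh² → ∞`. So `D` is taken large first, then the tolerance `η` small
(`exists_radius_increment_pos`).

Uniformity in `g` needs no chaining. A value `g(t)` is an `L²` pairing of `(g, g')` with kernels of
squared norms at most `1/h` and `h` (`exists_kernels`). A weighted empirical sum is therefore the
pairing of `(g, g')` with one random vector; Cauchy-Schwarz removes `g`, and a second moment with
Markov's inequality bounds the vector (`measure_not_empiricalBound_le`). Quadratic sums follow by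
inserting `g²`. The norm `‖g‖² + h²‖g'‖²` used there is controlled by `‖g‖²_{m,λ}` through
interpolation (`exists_sqNormL2_deriv_le`).

Existence of the spline is a finite dimensional compactness argument (`exists_isMTypeSpline`). The
error bound holds for every minimizer, so no measurable selection is involved. -/

/-- Lebesgue measure on `[0,1]`. -/
abbrev unitVolume : Measure ℝ := volume.restrict (Icc (0 : ℝ) 1)

/-! ### Primitives of square integrable functions, and Sobolev functions as towers of primitives. -/

/-- On `[0,1]`, the function `g` is a primitive of the square integrable function `φ`. -/
structure IsL2Primitive (g φ : ℝ → ℝ) : Prop where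
  memLp : MemLp φ 2 unitVolume
  eq_integral : ∀ x ∈ Icc (0 : ℝ) 1, g x = g 0 + ∫ s in (0 : ℝ)..x, φ s

theorem uniqueDiffOn_unit : UniqueDiffOn ℝ (Icc (0 : ℝ) 1) := uniqueDiffOn_Icc zero_lt_one

theorem ae_unitVolume_iff {p : ℝ → Prop} :
    (∀ᵐ x ∂unitVolume, p x) ↔ ∀ᵐ x, x ∈ Icc (0 : ℝ) 1 → p x :=
  ae_restrict_iff' measurableSet_Icc

theorem intervalIntegral_unit_eq (f : ℝ → ℝ) : ∫ x in (0 : ℝ)..1, f x = ∫ x, f x ∂unitVolume := by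
  rw [intervalIntegral.integral_of_le zero_le_one, integral_Icc_eq_integral_Ioc]

theorem MeasureTheory.Integrable.intervalIntegrable_unit {φ : ℝ → ℝ} (h : Integrable φ unitVolume)
    {a b : ℝ} (ha : a ∈ Icc (0 : ℝ) 1) (hb : b ∈ Icc (0 : ℝ) 1) :
    IntervalIntegrable φ volume a b := by
  have : IntegrableOn φ (uIcc a b) :=
    IntegrableOn.mono_set h (uIcc_subset_Icc ha hb)
  exact this.intervalIntegrable

theorem MeasureTheory.MemLp.integrable_unit {φ : ℝ → ℝ} (h : MemLp φ 2 unitVolume) :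
    Integrable φ unitVolume := h.integrable (by norm_num)

theorem ContinuousOn.memLp_unit {φ : ℝ → ℝ} (h : ContinuousOn φ (Icc 0 1)) :
    MemLp φ 2 unitVolume := by
  obtain ⟨C, hC⟩ := isCompact_Icc.exists_bound_of_continuousOn h
  refine MemLp.of_bound (h.aestronglyMeasurable measurableSet_Icc) C ?_
  exact ae_unitVolume_iff.2 (ae_of_all _ hC)

namespace IsL2Primitive

variable {g φ f ξ : ℝ → ℝ}

theorem intervalIntegrable (h : IsL2Primitive g φ) {a b : ℝ} (ha : a ∈ Icc (0 : ℝ) 1)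
    (hb : b ∈ Icc (0 : ℝ) 1) : IntervalIntegrable φ volume a b :=
  h.memLp.integrable_unit.intervalIntegrable_unit ha hb

theorem sub_eq_integral (h : IsL2Primitive g φ) {a b : ℝ} (ha : a ∈ Icc (0 : ℝ) 1)
    (hb : b ∈ Icc (0 : ℝ) 1) : g b - g a = ∫ s in a..b, φ s := by
  have h0 : (0 : ℝ) ∈ Icc (0 : ℝ) 1 := by simp
  rw [h.eq_integral a ha, h.eq_integral b hb,
    ← intervalIntegral.integral_interval_sub_left (h.intervalIntegrable h0 hb)
      (h.intervalIntegrable h0 ha)]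
  ring

theorem absCont (h : IsL2Primitive g φ) : AbsolutelyContinuousOnInterval g 0 1 := by
  have h1 := (h.intervalIntegrable (a := 0) (b := 1) (by simp)
    (by simp)).absolutelyContinuousOnInterval_intervalIntegral (c := 0) (by simp)
  have h2 : AbsolutelyContinuousOnInterval (fun _ : ℝ => g 0) 0 1 :=
    (LipschitzOnWith.absolutelyContinuousOnInterval (K := 0) (LipschitzWith.const _).lipschitzOnWith)
  have h3 := h2.fun_add h1
  -- The integral formula for `g` is available only on `[0,1]`, so the property is transferred
  -- through its ε-δ form, which looks at no other points.
  rw [absolutelyContinuousOnInterval_iff] at h3 ⊢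
  intro ε hε
  obtain ⟨δ, hδ, H⟩ := h3 ε hε
  refine ⟨δ, hδ, fun E hE hE' => ?_⟩
  refine lt_of_eq_of_lt (Finset.sum_congr rfl fun i hi => ?_) (H E hE hE')
  have hm := hE.1 i hi
  rw [uIcc_of_le zero_le_one] at hm
  rw [h.eq_integral _ hm.1, h.eq_integral _ hm.2]

theorem continuousOn (h : IsL2Primitive g φ) : ContinuousOn g (Icc 0 1) := by
  simpa using h.absCont.continuousOn

theorem memLp_self (h : IsL2Primitive g φ) : MemLp g 2 unitVolume := h.continuousOn.memLp_unit

theorem ae_hasDerivAt (h : IsL2Primitive g φ) :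
    ∀ᵐ x, x ∈ Icc (0 : ℝ) 1 → HasDerivAt g (φ x) x := by
  have h1 := (h.intervalIntegrable (a := 0) (b := 1) (by simp) (by simp)).ae_hasDerivAt_integral
  have h2 : ∀ᵐ x : ℝ, x ≠ 0 := by simp [ae_iff, measure_singleton]
  have h3 : ∀ᵐ x : ℝ, x ≠ 1 := by simp [ae_iff, measure_singleton]
  filter_upwards [h1, h2, h3] with x hx hx0 hx1 hxm
  have := (hx (by simpa using hxm) 0 (by simp)).const_add (g 0)
  refine this.congr_of_eventuallyEq ?_
  have hxo : x ∈ Ioo (0 : ℝ) 1 := ⟨lt_of_le_of_ne hxm.1 hx0.symm, lt_of_le_of_ne hxm.2 hx1⟩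
  filter_upwards [isOpen_Ioo.mem_nhds hxo] with y hy
  exact h.eq_integral y (Ioo_subset_Icc_self hy)

theorem of_absCont (hg : AbsolutelyContinuousOnInterval g 0 1) (hφ : MemLp φ 2 unitVolume)
    (hd : ∀ᵐ x, x ∈ Icc (0 : ℝ) 1 → HasDerivAt g (φ x) x) : IsL2Primitive g φ := by
  refine ⟨hφ, fun x hx => ?_⟩
  have hsub : uIcc 0 x ⊆ uIcc (0 : ℝ) 1 := by
    rw [uIcc_of_le hx.1, uIcc_of_le zero_le_one]; exact Icc_subset_Icc_right hx.2
  have h1 := (hg.mono hsub).integral_deriv_eq_sub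
  have h2 : ∫ s in (0 : ℝ)..x, φ s = ∫ s in (0 : ℝ)..x, deriv g s := by
    refine intervalIntegral.integral_congr_ae ?_
    filter_upwards [hd] with y hy hy'
    rw [uIoc_of_le hx.1] at hy'
    exact (hy ⟨hy'.1.le, hy'.2.trans hx.2⟩).deriv.symm
  rw [h2, h1]; ring

theorem congr_left (h : IsL2Primitive g φ) (hfg : EqOn f g (Icc 0 1)) : IsL2Primitive f φ :=
  ⟨h.memLp, fun x hx => by rw [hfg hx, hfg (by simp), h.eq_integral x hx]⟩

theorem add_const_mul (hg : IsL2Primitive g φ) (hf : IsL2Primitive f ξ) (c : ℝ) :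
    IsL2Primitive (fun x => g x + c * f x) (fun x => φ x + c * ξ x) := by
  refine ⟨hg.memLp.add (hf.memLp.const_mul c), fun x hx => ?_⟩
  rw [intervalIntegral.integral_add (hg.intervalIntegrable (by simp) hx)
    ((hf.intervalIntegrable (by simp) hx).const_mul c), intervalIntegral.integral_const_mul]
  simp only [hg.eq_integral x hx, hf.eq_integral x hx]
  ring

theorem mul (hg : IsL2Primitive g φ) (hf : IsL2Primitive f ξ) :
    IsL2Primitive (fun x => g x * f x) (fun x => φ x * f x + g x * ξ x) := by
  obtain ⟨C, hC⟩ := isCompact_Icc.exists_bound_of_continuousOn hf.continuousOn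
  obtain ⟨D, hD⟩ := isCompact_Icc.exists_bound_of_continuousOn hg.continuousOn
  refine of_absCont (hg.absCont.fun_mul hf.absCont) (MemLp.add ?_ ?_) ?_
  · refine MemLp.of_le_mul (c := C) hg.memLp
      (hg.memLp.1.mul (hf.continuousOn.aestronglyMeasurable measurableSet_Icc)) ?_
    refine ae_unitVolume_iff.2 (ae_of_all _ fun x hx => ?_)
    rw [norm_mul, mul_comm]
    exact mul_le_mul_of_nonneg_right (hC x hx) (norm_nonneg _)
  · refine MemLp.of_le_mul (c := D) hf.memLp
      ((hg.continuousOn.aestronglyMeasurable measurableSet_Icc).mul hf.memLp.1) ?_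
    refine ae_unitVolume_iff.2 (ae_of_all _ fun x hx => ?_)
    rw [norm_mul]
    exact mul_le_mul_of_nonneg_right (hD x hx) (norm_nonneg _)
  · filter_upwards [hg.ae_hasDerivAt, hf.ae_hasDerivAt] with x h1 h2 hx
    exact (h1 hx).mul (h2 hx)

theorem ae_derivWithin (h : IsL2Primitive g φ) :
    derivWithin g (Icc 0 1) =ᵐ[unitVolume] φ := by
  refine ae_unitVolume_iff.2 ?_
  filter_upwards [h.ae_hasDerivAt] with x hx hxm
  exact (hx hxm).hasDerivWithinAt.derivWithin (uniqueDiffOn_unit x hxm)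

theorem hasDerivWithinAt (h : IsL2Primitive g φ) (hφ : ContinuousOn φ (Icc 0 1)) {x : ℝ}
    (hx : x ∈ Icc (0 : ℝ) 1) : HasDerivWithinAt g (φ x) (Icc 0 1) x := by
  have : Fact (x ∈ Icc (0 : ℝ) 1) := ⟨hx⟩
  have h1 := (intervalIntegral.integral_hasDerivWithinAt_right (a := 0) (b := x)
    (h.intervalIntegrable (by simp) hx) (s := Icc 0 1) (t := Icc 0 1)
    (hφ.stronglyMeasurableAtFilter_nhdsWithin measurableSet_Icc x) (hφ x hx)).const_add (g 0)
  exact h1.congr (fun y hy => h.eq_integral y hy) (h.eq_integral x hx)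

end IsL2Primitive

theorem derivUnit_succ (k : ℕ) (f : ℝ → ℝ) :
    derivUnit (k + 1) f = derivWithin (derivUnit k f) (Icc 0 1) := iteratedDerivWithin_succ

theorem derivUnit_zero (f : ℝ → ℝ) : derivUnit 0 f = f := iteratedDerivWithin_zero

/-- Below the top order the derivative is classical and continuous; at `j = m - 1` absolute
continuity takes over. After this, all calculus is done with primitives. -/
theorem MemSobolev.isL2Primitive {m : ℕ} {f : ℝ → ℝ} (h : MemSobolev m f) (hm : 1 ≤ m) {j : ℕ}
    (hj : j < m) : IsL2Primitive (derivUnit j f) (derivUnit (j + 1) f) := by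
  obtain ⟨k, rfl⟩ : ∃ k, m = k + 1 := ⟨m - 1, by omega⟩
  have hC := h.contDiffOn
  simp only [Nat.add_sub_cancel] at hC
  rcases Nat.lt_or_ge j k with hjk | hjk
  · have hd : DifferentiableOn ℝ (derivUnit j f) (Icc 0 1) :=
      hC.differentiableOn_iteratedDerivWithin (by exact_mod_cast hjk) uniqueDiffOn_unit
    have hc : ContinuousOn (derivUnit (j + 1) f) (Icc 0 1) :=
      hC.continuousOn_iteratedDerivWithin (by exact_mod_cast hjk) uniqueDiffOn_unit
    have hder : ∀ x ∈ Icc (0 : ℝ) 1,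
        HasDerivWithinAt (derivUnit j f) (derivUnit (j + 1) f x) (Icc 0 1) x := fun x hx => by
      rw [derivUnit_succ]; exact (hd x hx).hasDerivWithinAt
    refine ⟨hc.memLp_unit, fun x hx => ?_⟩
    rw [intervalIntegral.integral_eq_sub_of_hasDerivAt_of_le hx.1
      (hd.continuousOn.mono (Icc_subset_Icc_right hx.2))
      (fun y hy => (hder y ⟨hy.1.le, hy.2.le.trans hx.2⟩).hasDerivAt
        (Icc_mem_nhds hy.1 (hy.2.trans_le hx.2)))
      (hc.memLp_unit.integrable_unit.intervalIntegrable_unit (by simp) hx)]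
    ring
  · obtain rfl : j = k := by omega
    have hac := h.absCont
    simp only [Nat.add_sub_cancel] at hac
    refine IsL2Primitive.of_absCont hac h.memLp ?_
    have h2 : ∀ᵐ x : ℝ, x ≠ 0 := by simp [ae_iff, measure_singleton]
    have h3 : ∀ᵐ x : ℝ, x ≠ 1 := by simp [ae_iff, measure_singleton]
    filter_upwards [hac.ae_differentiableAt, h2, h3] with x hx hx0 hx1 hxm
    rw [derivUnit_succ]
    exact (hx (by simpa using hxm)).differentiableWithinAt.hasDerivWithinAt.hasDerivAt
      (Icc_mem_nhds (lt_of_le_of_ne hxm.1 hx0.symm) (lt_of_le_of_ne hxm.2 hx1))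

section Tower

variable {m : ℕ} {F : ℕ → ℝ → ℝ}

/-- A tower has each `F j` a primitive of `F (j + 1)`. For `j + 1 < m` the function `F (j + 1)` is
itself a primitive, hence continuous, so the derivative exists at every point; only the last one is
almost everywhere. -/
theorem derivUnit_eqOn_of_tower (hF : ∀ j < m, IsL2Primitive (F j) (F (j + 1))) :
    ∀ j < m, EqOn (derivUnit j (F 0)) (F j) (Icc 0 1) := by
  intro j
  induction j with
  | zero => intro _; rw [derivUnit_zero]; exact fun x _ => rfl
  | succ j ih =>
    intro hj x hx
    have h1 := ih (by omega)
    rw [derivUnit_succ, derivWithin_congr h1 (h1 hx)]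
    exact ((hF j (by omega)).hasDerivWithinAt (hF (j + 1) hj).continuousOn hx).derivWithin
      (uniqueDiffOn_unit x hx)

theorem derivUnit_ae_of_tower (hm : 1 ≤ m) (hF : ∀ j < m, IsL2Primitive (F j) (F (j + 1))) :
    derivUnit m (F 0) =ᵐ[unitVolume] F m := by
  obtain ⟨k, rfl⟩ : ∃ k, m = k + 1 := ⟨m - 1, by omega⟩
  have h1 := derivUnit_eqOn_of_tower hF k (by omega)
  have h2 := ((hF k (by omega)).congr_left h1).ae_derivWithin
  rwa [← derivUnit_succ] at h2

theorem memSobolev_of_tower (hm : 1 ≤ m) (hF : ∀ j < m, IsL2Primitive (F j) (F (j + 1))) :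
    MemSobolev m (F 0) := by
  have h1 := derivUnit_eqOn_of_tower hF
  have h2 := derivUnit_ae_of_tower hm hF
  obtain ⟨k, rfl⟩ : ∃ k, m = k + 1 := ⟨m - 1, by omega⟩
  refine ⟨?_, ((hF k (by omega)).congr_left (h1 k (by omega))).absCont,
    (memLp_congr_ae h2).2 (hF k (by omega)).memLp⟩
  simp only [Nat.add_sub_cancel]
  have := (contDiffOn_nat_iff_continuousOn_differentiableOn_deriv (𝕜 := ℝ) (n := k) (f := F 0)
    uniqueDiffOn_unit).2 ⟨fun j hj => ?_, fun j hj => ?_⟩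
  · exact_mod_cast this
  · exact (hF j (by omega)).continuousOn.congr (h1 j (by omega))
  · intro x hx
    exact (((hF j (by omega)).congr_left (h1 j (by omega))).hasDerivWithinAt
      (hF (j + 1) (by omega)).continuousOn hx).differentiableWithinAt

end Tower

theorem MemSobolev.tower_add_const_mul {m : ℕ} (hm : 1 ≤ m) {f g : ℝ → ℝ} (hf : MemSobolev m f)
    (hg : MemSobolev m g) (c : ℝ) : ∀ j < m, IsL2Primitive
      (fun x => derivUnit j f x + c * derivUnit j g x)
      (fun x => derivUnit (j + 1) f x + c * derivUnit (j + 1) g x) :=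
  fun _ hj => (hf.isL2Primitive hm hj).add_const_mul (hg.isL2Primitive hm hj) c

theorem MemSobolev.add_const_mul {m : ℕ} (hm : 1 ≤ m) {f g : ℝ → ℝ} (hf : MemSobolev m f)
    (hg : MemSobolev m g) (c : ℝ) : MemSobolev m (fun x => f x + c * g x) := by
  simpa [derivUnit_zero] using
    memSobolev_of_tower (F := fun j x => derivUnit j f x + c * derivUnit j g x) hm
      (hf.tower_add_const_mul hm hg c)

theorem MemSobolev.derivUnit_add_const_mul {m : ℕ} (hm : 1 ≤ m) {f g : ℝ → ℝ}
    (hf : MemSobolev m f) (hg : MemSobolev m g) (c : ℝ) :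
    derivUnit m (fun x => f x + c * g x) =ᵐ[unitVolume]
      fun x => derivUnit m f x + c * derivUnit m g x := by
  simpa [derivUnit_zero] using
    derivUnit_ae_of_tower (F := fun j x => derivUnit j f x + c * derivUnit j g x) hm
      (hf.tower_add_const_mul hm hg c)

theorem IsL2Primitive.tower {g φ : ℝ → ℝ} (h : IsL2Primitive g φ) : ∀ j < 1,
    IsL2Primitive ((fun j => if j = 0 then g else φ : ℕ → ℝ → ℝ) j)
      ((fun j => if j = 0 then g else φ : ℕ → ℝ → ℝ) (j + 1)) := by
  intro j hj
  obtain rfl : j = 0 := by omega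
  simpa using h

theorem IsL2Primitive.memSobolev {g φ : ℝ → ℝ} (h : IsL2Primitive g φ) : MemSobolev 1 g := by
  simpa using memSobolev_of_tower le_rfl h.tower

theorem IsL2Primitive.derivUnit_ae {g φ : ℝ → ℝ} (h : IsL2Primitive g φ) :
    derivUnit 1 g =ᵐ[unitVolume] φ := by
  simpa using derivUnit_ae_of_tower le_rfl h.tower

/-! ### The `L²` norm and Cauchy-Schwarz on the unit interval. -/

theorem sqNormL2_congr {f g : ℝ → ℝ} (h : f =ᵐ[unitVolume] g) : sqNormL2 f = sqNormL2 g := by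
  unfold sqNormL2
  rw [intervalIntegral_unit_eq, intervalIntegral_unit_eq]
  exact integral_congr_ae (h.mono fun x hx => by simp only [hx])

theorem sqNormL2_nonneg (f : ℝ → ℝ) : 0 ≤ sqNormL2 f :=
  intervalIntegral.integral_nonneg zero_le_one fun _ _ => sq_nonneg _

theorem inner_toLp_unit {f g : ℝ → ℝ} (hf : MemLp f 2 unitVolume) (hg : MemLp g 2 unitVolume) :
    inner ℝ (hf.toLp f) (hg.toLp g) = ∫ x, f x * g x ∂unitVolume := by
  rw [L2.inner_def]
  refine integral_congr_ae ?_
  filter_upwards [hf.coeFn_toLp, hg.coeFn_toLp] with x h1 h2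
  rw [h1, h2]
  simp [mul_comm]

theorem norm_toLp_unit_sq {f : ℝ → ℝ} (hf : MemLp f 2 unitVolume) :
    ‖hf.toLp f‖ ^ 2 = sqNormL2 f := by
  rw [← real_inner_self_eq_norm_sq, inner_toLp_unit hf hf, sqNormL2, intervalIntegral_unit_eq]
  simp only [sq]

theorem norm_toLp_unit {f : ℝ → ℝ} (hf : MemLp f 2 unitVolume) :
    ‖hf.toLp f‖ = √(sqNormL2 f) := by
  rw [← norm_toLp_unit_sq hf, Real.sqrt_sq (norm_nonneg _)]

theorem abs_integral_mul_le {f g : ℝ → ℝ} (hf : MemLp f 2 unitVolume)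
    (hg : MemLp g 2 unitVolume) :
    |∫ x, f x * g x ∂unitVolume| ≤ √(sqNormL2 f) * √(sqNormL2 g) := by
  rw [← inner_toLp_unit hf hg, ← norm_toLp_unit hf, ← norm_toLp_unit hg]
  exact abs_real_inner_le_norm _ _

theorem sqNormL2_abs (f : ℝ → ℝ) : sqNormL2 (fun x => |f x|) = sqNormL2 f := by
  simp [sqNormL2]

theorem integral_abs_mul_le {f g : ℝ → ℝ} (hf : MemLp f 2 unitVolume)
    (hg : MemLp g 2 unitVolume) :
    ∫ x, |f x * g x| ∂unitVolume ≤ √(sqNormL2 f) * √(sqNormL2 g) := by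
  have := (le_abs_self _).trans (abs_integral_mul_le hf.abs hg.abs)
  simp only [Pi.abs_apply, ← abs_mul] at this
  rwa [show |f| = fun x => |f x| from rfl, show |g| = fun x => |g x| from rfl, sqNormL2_abs,
    sqNormL2_abs] at this

theorem MeasureTheory.MemLp.integrable_unit_sq {f : ℝ → ℝ} (hf : MemLp f 2 unitVolume) :
    Integrable (fun x => f x ^ 2) unitVolume := hf.integrable_sq

theorem sqNormL2_eq (f : ℝ → ℝ) : sqNormL2 f = ∫ x, f x ^ 2 ∂unitVolume :=
  intervalIntegral_unit_eq _

instance : IsProbabilityMeasure unitVolume := ⟨by simp⟩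

/-! ### Sup norm and interpolation inequalities. -/

/-- Here `a`, `b`, `c` stand for the norms of `g`, `g'`, `g''`. If `b > 16 X` with `X = w⁻¹ a + w
c`, then `a ≤ b/16` and `a c ≤ b²/256`, so the right side of `main` is at most `(1/256 + 4/5) b²`,
less than `b²`. -/
theorem le_of_sq_le_mul_add_sqrt {a b c w : ℝ} (hw : 0 < w) (hw1 : w ≤ 1) (a0 : 0 ≤ a)
    (c0 : 0 ≤ c)
    (main : b ^ 2 ≤ a * c + 2 * √((a ^ 2 + 2 * (a * b)) * (b ^ 2 + 2 * (b * c)))) :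
    b ≤ 16 * (w⁻¹ * a + w * c) := by
  set X := w⁻¹ * a + w * c with hX
  have X0 : 0 ≤ X := by positivity
  have aX : a ≤ X := by
    have h1 : a ≤ w⁻¹ * a := le_mul_of_one_le_left a0 ((one_le_inv₀ hw).2 hw1)
    linarith [mul_nonneg hw.le c0]
  have acX : a * c ≤ X ^ 2 := by
    have h1 : a * c = (w⁻¹ * a) * (w * c) := by field_simp
    have p1 : 0 ≤ w⁻¹ * a := by positivity
    have p2 : 0 ≤ w * c := by positivity
    rw [h1, hX]
    nlinarith only [p1, p2, mul_nonneg p1 p2, sq_nonneg (w⁻¹ * a), sq_nonneg (w * c)]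
  clear_value X
  by_contra! hcon
  have hb : 0 < b := by linarith
  have hXb : X ≤ b / 16 := by linarith
  have acb : a * c ≤ (b / 16) ^ 2 := acX.trans (by gcongr)
  have hab : a ≤ b / 16 := aX.trans hXb
  have hPQ : (a ^ 2 + 2 * (a * b)) * (b ^ 2 + 2 * (b * c)) ≤ (2 / 5 * b ^ 2) ^ 2 := by
    have e : (a ^ 2 + 2 * (a * b)) * (b ^ 2 + 2 * (b * c)) =
        a ^ 2 * b ^ 2 + 2 * (a * (a * c)) * b + 2 * a * b ^ 3 + 4 * b ^ 2 * (a * c) := by ring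
    have i1 : a ^ 2 * b ^ 2 ≤ (b / 16) ^ 2 * b ^ 2 := by gcongr
    have i2 : 2 * (a * (a * c)) * b ≤ 2 * ((b / 16) * (b / 16) ^ 2) * b := by gcongr
    have i3 : 2 * a * b ^ 3 ≤ 2 * (b / 16) * b ^ 3 := by gcongr
    have i4 : 4 * b ^ 2 * (a * c) ≤ 4 * b ^ 2 * (b / 16) ^ 2 := by gcongr
    have i5 : 0 < b ^ 4 := by positivity
    rw [e]
    refine (add_le_add (add_le_add (add_le_add i1 i2) i3) i4).trans ?_
    ring_nf
    linarith
  have hs : √((a ^ 2 + 2 * (a * b)) * (b ^ 2 + 2 * (b * c))) ≤ 2 / 5 * b ^ 2 :=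
    Real.sqrt_le_iff.2 ⟨by positivity, hPQ⟩
  have hb2 : 0 < b ^ 2 := by positivity
  rw [div_pow] at acb
  linarith

namespace IsL2Primitive

variable {g φ ξ : ℝ → ℝ}

/-- Write `g(x)² - g(y)²` as the integral of `2 g φ` from `y` to `x` and average over `y`. -/
theorem sq_le (h : IsL2Primitive g φ) {x : ℝ} (hx : x ∈ Icc (0 : ℝ) 1) :
    g x ^ 2 ≤ sqNormL2 g + 2 * (√(sqNormL2 g) * √(sqNormL2 φ)) := by
  have hint : Integrable (fun s => g s * φ s) unitVolume := h.memLp_self.integrable_mul h.memLp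
  have key : ∀ y ∈ Icc (0 : ℝ) 1, g x ^ 2 ≤ g y ^ 2 + 2 * ∫ s, |g s * φ s| ∂unitVolume := by
    intro y hy
    have h1 := (h.mul h).sub_eq_integral hy hx
    have h2 : |∫ s in y..x, (φ s * g s + g s * φ s)| ≤
        ∫ s in uIoc y x, |φ s * g s + g s * φ s| := by
      simpa using intervalIntegral.norm_integral_le_integral_norm_uIoc
        (f := fun s => φ s * g s + g s * φ s) (a := y) (b := x) (μ := volume)
    have h3 : ∫ s in uIoc y x, |φ s * g s + g s * φ s| ≤
        ∫ s in Icc 0 1, |φ s * g s + g s * φ s| := by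
      refine setIntegral_mono_set ?_ (ae_of_all _ fun s => abs_nonneg _) ?_
      · refine ((hint.const_mul 2).abs).congr (ae_of_all _ fun s => ?_)
        simp only
        congr 1; ring
      · exact (uIoc_subset_uIcc.trans (uIcc_subset_Icc hy hx)).eventuallyLE
    have h4 : ∫ s in Icc 0 1, |φ s * g s + g s * φ s| = 2 * ∫ s, |g s * φ s| ∂unitVolume := by
      rw [← integral_const_mul]
      refine integral_congr_ae (ae_of_all _ fun s => ?_)
      simp only
      rw [show φ s * g s + g s * φ s = 2 * (g s * φ s) by ring, abs_mul, abs_two]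
    have := le_abs_self (∫ s in y..x, (φ s * g s + g s * φ s))
    nlinarith
  have h5 : ∫ y, g x ^ 2 ∂unitVolume ≤
      ∫ y, (g y ^ 2 + 2 * ∫ s, |g s * φ s| ∂unitVolume) ∂unitVolume := by
    refine integral_mono_ae (integrable_const _)
      (h.memLp_self.integrable_unit_sq.add (integrable_const _)) ?_
    exact ae_unitVolume_iff.2 (ae_of_all _ key)
  rw [integral_add h.memLp_self.integrable_unit_sq (integrable_const _)] at h5
  simp only [integral_const, probReal_univ, smul_eq_mul, one_mul] at h5
  rw [← sqNormL2_eq] at h5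
  linarith [integral_abs_mul_le h.memLp_self h.memLp]

theorem sq_le_of_bandwidth (h : IsL2Primitive g φ) {w : ℝ} (hw : 0 < w) (hw1 : w ≤ 1) {x : ℝ}
    (hx : x ∈ Icc (0 : ℝ) 1) :
    g x ^ 2 ≤ 2 / w * (sqNormL2 g + w ^ 2 * sqNormL2 φ) := by
  have h1 := h.sq_le hx
  have h0 := sqNormL2_nonneg g
  have h2 := Real.sq_sqrt h0
  have h3 := Real.sq_sqrt (sqNormL2_nonneg φ)
  set a := √(sqNormL2 g)
  set b := √(sqNormL2 φ)
  rw [← h2, ← h3] at *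
  rw [div_mul_eq_mul_div, le_div_iff₀ hw]
  nlinarith [sq_nonneg (a - w * b), mul_le_mul_of_nonneg_right h1 hw.le,
    mul_nonneg (sub_nonneg.2 hw1) (sq_nonneg a), sq_nonneg (w * b)]

/-- Interpolation of the first derivative between a function and its second derivative. -/
theorem sqrt_sqNormL2_le (h : IsL2Primitive g φ) (h' : IsL2Primitive φ ξ) {w : ℝ} (hw : 0 < w)
    (hw1 : w ≤ 1) :
    √(sqNormL2 φ) ≤ 16 * (w⁻¹ * √(sqNormL2 g) + w * √(sqNormL2 ξ)) := by
  -- Integration by parts: `∫ φ² = [g φ]₀¹ - ∫ g ξ`. The boundary terms are bounded by `sq_le` at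
  -- both end points, for `g` and for `φ`.
  have e1 := (h.mul h').sub_eq_integral (a := 0) (b := 1) (by simp) (by simp)
  have i1 : Integrable (fun x => φ x * φ x) unitVolume := h'.memLp_self.integrable_mul h'.memLp_self
  have i2 : Integrable (fun x => g x * ξ x) unitVolume := h.memLp_self.integrable_mul h'.memLp
  rw [intervalIntegral_unit_eq, integral_add i1 i2] at e1
  have e2 : ∫ x, φ x * φ x ∂unitVolume = sqNormL2 φ := by
    rw [sqNormL2_eq]; simp only [sq]
  rw [e2] at e1
  have c1 := abs_integral_mul_le h.memLp_self h'.memLp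
  have s1 := h.sq_le (x := 0) (by simp)
  have s2 := h.sq_le (x := 1) (by simp)
  have s3 := h'.sq_le (x := 0) (by simp)
  have s4 := h'.sq_le (x := 1) (by simp)
  have h2 := Real.sq_sqrt (sqNormL2_nonneg g)
  have h3 := Real.sq_sqrt (sqNormL2_nonneg φ)
  have a0 := Real.sqrt_nonneg (sqNormL2 g)
  have c0 := Real.sqrt_nonneg (sqNormL2 ξ)
  set a := √(sqNormL2 g)
  set b := √(sqNormL2 φ)
  set c := √(sqNormL2 ξ)
  rw [← h2] at s1 s2
  rw [← h3] at s3 s4 e1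
  set P := a ^ 2 + 2 * (a * b)
  set Q := b ^ 2 + 2 * (b * c)
  have hP : 0 ≤ P := by positivity
  have hQ : 0 ≤ Q := by positivity
  have t : ∀ y z : ℝ, y ^ 2 ≤ P → z ^ 2 ≤ Q → |y * z| ≤ √(P * Q) := fun y z hy hz => by
    refine Real.abs_le_sqrt ?_
    rw [mul_pow]
    exact mul_le_mul hy hz (sq_nonneg _) hP
  have t1 := t _ _ s1 s3
  have t2 := t _ _ s2 s4
  have main : b ^ 2 ≤ a * c + 2 * √(P * Q) := by
    have := neg_abs_le (∫ x, g x * ξ x ∂unitVolume)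
    have := neg_abs_le (g 0 * φ 0)
    have := le_abs_self (g 1 * φ 1)
    linarith
  exact le_of_sq_le_mul_add_sqrt hw hw1 a0 c0 main

end IsL2Primitive

/-- Applied to scaled derivative norms `a j`. In the induction step `θ = η/32` and the inductive
tolerance `η/32²` leave half of `a (k + 1)` on the right, which is absorbed on the left and doubles
the coefficient `16 θ = η/2` to `η`. -/
theorem le_add_mul_of_interpolation (k : ℕ) : ∀ η : ℝ, 0 < η → η ≤ 1 → ∃ C : ℝ, 0 ≤ C ∧
    ∀ a : ℕ → ℝ, (∀ j, 0 ≤ a j) → (∀ j < k, ∀ θ : ℝ, 0 < θ → θ ≤ 1 →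
      a (j + 1) ≤ 16 * (θ⁻¹ * a j + θ * a (j + 2))) → a k ≤ C * a 0 + η * a (k + 1) := by
  induction k with
  | zero =>
    intro η hη _
    exact ⟨1, zero_le_one, fun a ha _ => by nlinarith [ha (0 + 1)]⟩
  | succ k ih =>
    intro η hη hη1
    obtain ⟨C, hC, H⟩ := ih (η / 32 / 32) (by positivity) (by linarith)
    refine ⟨32 * (η / 32)⁻¹ * C, by positivity, fun a ha h => ?_⟩
    have h1 := H a ha fun j hj => h j (by omega)
    have h2 := h k (by omega) (η / 32) (by positivity) (by linarith)
    have h3 : (η / 32)⁻¹ * a k ≤ (η / 32)⁻¹ * (C * a 0 + η / 32 / 32 * a (k + 1)) := by gcongr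
    have h4 : (η / 32)⁻¹ * (C * a 0 + η / 32 / 32 * a (k + 1)) =
        (η / 32)⁻¹ * C * a 0 + a (k + 1) / 32 := by field_simp
    rw [show k + 1 + 1 = k + 2 from rfl]
    linarith

theorem le_mul_add_of_interpolation (m : ℕ) : ∃ C : ℝ, 0 ≤ C ∧
    ∀ a : ℕ → ℝ, (∀ j, 0 ≤ a j) → (∀ j < m, ∀ θ : ℝ, 0 < θ → θ ≤ 1 →
      a (j + 1) ≤ 16 * (θ⁻¹ * a j + θ * a (j + 2))) → a 1 ≤ C * (a 0 + a (m + 1)) := by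
  induction m with
  | zero => exact ⟨1, zero_le_one, fun a ha _ => by simpa using ha 0⟩
  | succ m ih =>
    obtain ⟨C, hC, H⟩ := ih
    obtain ⟨D, hD, H'⟩ := le_add_mul_of_interpolation (m + 1) 1 one_pos le_rfl
    refine ⟨C * (1 + D), by positivity, fun a ha h => ?_⟩
    have h1 := H a ha fun j hj => h j (by omega)
    have h2 := H' a ha h
    have := mul_le_mul_of_nonneg_left h2 hC
    have := mul_nonneg (mul_nonneg hC hD) (ha (m + 1 + 1))
    nlinarith

/-- Interpolation of the first derivative between a function and its `m`-th derivative, at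
bandwidth `w`. -/
theorem exists_sqNormL2_deriv_le {m : ℕ} (hm : 1 ≤ m) : ∃ C : ℝ, 0 < C ∧ ∀ w : ℝ, 0 < w → w ≤ 1 →
    ∀ f : ℝ → ℝ, MemSobolev m f →
      w ^ 2 * sqNormL2 (derivUnit 1 f) ≤
        C * (sqNormL2 f + w ^ (2 * m) * sqNormL2 (derivUnit m f)) := by
  obtain ⟨k, rfl⟩ : ∃ k, m = k + 1 := ⟨m - 1, by omega⟩
  obtain ⟨C, hC, H⟩ := le_mul_add_of_interpolation k
  refine ⟨2 * C ^ 2 + 1, by positivity, fun w hw hw1 f hf => ?_⟩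
  -- The weights `w ^ j` turn interpolation at bandwidth `θ w` into the hypothesis on `θ` with no
  -- `w` left.
  have h1 := H (fun j => w ^ j * √(sqNormL2 (derivUnit j f))) (fun j => by positivity) ?_
  · simp only [pow_one, pow_zero, one_mul, derivUnit_zero] at h1
    have q0 := Real.sq_sqrt (sqNormL2_nonneg f)
    have q1 := Real.sq_sqrt (sqNormL2_nonneg (derivUnit 1 f))
    have qm := Real.sq_sqrt (sqNormL2_nonneg (derivUnit (k + 1) f))
    have h2 := pow_le_pow_left₀ (by positivity) h1 2
    rw [mul_pow, mul_pow, q1] at h2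
    have e : (w ^ (k + 1) * √(sqNormL2 (derivUnit (k + 1) f))) ^ 2 =
        w ^ (2 * (k + 1)) * sqNormL2 (derivUnit (k + 1) f) := by
      rw [mul_pow, qm, ← pow_mul, mul_comm 2]
    set b := w ^ (k + 1) * √(sqNormL2 (derivUnit (k + 1) f))
    set a := √(sqNormL2 f)
    rw [← e, ← q0]
    have h3 : (a + b) ^ 2 ≤ 2 * (a ^ 2 + b ^ 2) := by nlinarith [sq_nonneg (a - b)]
    have := mul_le_mul_of_nonneg_left h3 (sq_nonneg C)
    nlinarith [sq_nonneg a, sq_nonneg b]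
  · intro j hj θ hθ hθ1
    have h2 := (hf.isL2Primitive hm (j := j) (by omega)).sqrt_sqNormL2_le
      (hf.isL2Primitive hm (j := j + 1) (by omega)) (w := θ * w) (by positivity)
      (mul_le_one₀ hθ1 hw.le hw1)
    have h3 := mul_le_mul_of_nonneg_left h2 (pow_pos hw (j + 1)).le
    refine h3.trans_eq ?_
    have : w ≠ 0 := hw.ne'
    field_simp
    ring

/-! ### Kernel representation of point values. -/

/-- The value at `t` is represented by a pair of square integrable kernels of bandwidth `w`. -/
theorem exists_kernels {t w : ℝ} (ht : t ∈ Icc (0 : ℝ) 1) (hw : 0 < w) (hw1 : w ≤ 1) :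
    ∃ A B : ℝ → ℝ, MemLp A 2 unitVolume ∧ MemLp B 2 unitVolume ∧ sqNormL2 A ≤ w⁻¹ ∧
      sqNormL2 B ≤ w ∧ ∀ g φ : ℝ → ℝ, IsL2Primitive g φ →
        g t = ∫ x, A x * g x ∂unitVolume + ∫ x, B x * φ x ∂unitVolume := by
  obtain ⟨ht0, ht1⟩ := ht
  -- The window `[a, a + w]` has length `w`, contains `t` and stays in `[0,1]` even when `t` is near
  -- an end point.
  set a := t * (1 - w) with ha
  set b := a + w with hb
  have hat : a ≤ t := by nlinarith
  have htb : t ≤ b := by nlinarith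
  have ha0 : 0 ≤ a := mul_nonneg ht0 (by linarith)
  have hb1 : b ≤ 1 := by nlinarith
  have haI : a ∈ Icc (0 : ℝ) 1 := ⟨ha0, by linarith⟩
  have hbI : b ∈ Icc (0 : ℝ) 1 := ⟨by linarith, hb1⟩
  have htI : t ∈ Icc (0 : ℝ) 1 := ⟨ht0, ht1⟩
  have hind : ∀ {c d : ℝ}, c ∈ Icc (0 : ℝ) 1 → d ∈ Icc (0 : ℝ) 1 → c ≤ d → ∀ F : ℝ → ℝ,
      ∫ x, (Ioc c d).indicator F x ∂unitVolume = ∫ x in c..d, F x := by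
    intro c d hc hd hcd F
    rw [integral_indicator measurableSet_Ioc, Measure.restrict_restrict measurableSet_Ioc,
      inter_eq_left.2 (Ioc_subset_Icc_self.trans (Icc_subset_Icc hc.1 hd.2)),
      intervalIntegral.integral_of_le hcd]
  have hindL : ∀ {c d : ℝ} {F : ℝ → ℝ}, Continuous F → MemLp ((Ioc c d).indicator F) 2 unitVolume :=
    fun hF => hF.continuousOn.memLp_unit.indicator measurableSet_Ioc
  -- The kernels come from integrating the derivatives of `(s - a) g` over `[a, t]` and of `(s - b)
  -- g` over `[t, b]`: the boundary terms add up to `w g(t)`.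
  let A : ℝ → ℝ := (Ioc a b).indicator fun _ => w⁻¹
  let B₁ : ℝ → ℝ := (Ioc a t).indicator fun s => w⁻¹ * (s - a)
  let B₂ : ℝ → ℝ := (Ioc t b).indicator fun s => w⁻¹ * (s - b)
  have hA : MemLp A 2 unitVolume := hindL continuous_const
  have hB₁ : MemLp B₁ 2 unitVolume := hindL (by fun_prop)
  have hB₂ : MemLp B₂ 2 unitVolume := hindL (by fun_prop)
  have hab : a ≤ b := hat.trans htb
  refine ⟨A, fun x => B₁ x + B₂ x, hA, hB₁.add hB₂, ?_, ?_, ?_⟩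
  · have e : ∀ x, A x ^ 2 = (Ioc a b).indicator (fun _ => w⁻¹ ^ 2) x := fun x => by
      by_cases hx : x ∈ Ioc a b <;> simp [A, hx]
    rw [sqNormL2_eq]
    simp only [e]
    rw [hind haI hbI hab, intervalIntegral.integral_const]
    refine le_of_eq ?_
    rw [hb, smul_eq_mul]; field_simp; ring
  · have e : ∀ x, (B₁ x + B₂ x) ^ 2 ≤ (Ioc a b).indicator (fun _ => 1) x := fun x => by
      have ow : w⁻¹ * w = 1 := inv_mul_cancel₀ hw.ne'
      have iw : 0 < w⁻¹ := inv_pos.2 hw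
      by_cases h1 : x ∈ Ioc a t
      · have h2 : x ∉ Ioc t b := fun h => absurd h.1 (not_lt.2 h1.2)
        have h3 : x ∈ Ioc a b := ⟨h1.1, h1.2.trans htb⟩
        simp only [B₁, B₂, indicator_of_mem h1, indicator_of_notMem h2, indicator_of_mem h3]
        have l : 0 ≤ w⁻¹ * (x - a) := mul_nonneg iw.le (by linarith [h1.1])
        have u : w⁻¹ * (x - a) ≤ 1 := by
          rw [← ow]; exact mul_le_mul_of_nonneg_left (by linarith [h1.2]) iw.le
        nlinarith
      · by_cases h2 : x ∈ Ioc t b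
        · have h3 : x ∈ Ioc a b := ⟨lt_of_le_of_lt hat h2.1, h2.2⟩
          simp only [B₁, B₂, indicator_of_notMem h1, indicator_of_mem h2, indicator_of_mem h3]
          have l : w⁻¹ * (x - b) ≤ 0 := mul_nonpos_of_nonneg_of_nonpos iw.le (by linarith [h2.2])
          have u : -1 ≤ w⁻¹ * (x - b) := by
            rw [← ow, ← mul_neg]; exact mul_le_mul_of_nonneg_left (by linarith [h2.1]) iw.le
          nlinarith
        · simp only [B₁, B₂, indicator_of_notMem h1, indicator_of_notMem h2]
          simpa using indicator_nonneg (fun _ _ => zero_le_one) x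
    rw [sqNormL2_eq]
    refine (integral_mono (hB₁.add hB₂).integrable_sq ?_ e).trans ?_
    · exact (integrable_const (1 : ℝ)).indicator measurableSet_Ioc
    · rw [hind haI hbI hab, intervalIntegral.integral_const, hb]; simp
  · intro g φ h
    have lin : ∀ c : ℝ, IsL2Primitive (fun s => s - c) (fun _ => 1) := fun c =>
      ⟨memLp_const _, fun x _ => by simp; ring⟩
    have p1 := ((lin a).mul h).sub_eq_integral haI htI
    have p2 := ((lin b).mul h).sub_eq_integral htI hbI
    have hg := fun {c d : ℝ} (hc : c ∈ Icc (0 : ℝ) 1) (hd : d ∈ Icc (0 : ℝ) 1) =>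
      h.memLp_self.integrable_unit.intervalIntegrable_unit hc hd
    have hφ : ∀ (e : ℝ) {c d : ℝ}, c ∈ Icc (0 : ℝ) 1 → d ∈ Icc (0 : ℝ) 1 →
        IntervalIntegrable (fun s => (s - e) * φ s) volume c d := fun e {c d} hc hd =>
      (h.intervalIntegrable hc hd).continuousOn_mul (by fun_prop)
    simp only [one_mul] at p1 p2
    rw [intervalIntegral.integral_add (hg haI htI) (hφ a haI htI)] at p1
    rw [intervalIntegral.integral_add (hg htI hbI) (hφ b htI hbI)] at p2
    have q0 : ∫ x, A x * g x ∂unitVolume = w⁻¹ * ∫ x in a..b, g x := by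
      rw [← intervalIntegral.integral_const_mul, ← hind haI hbI hab]
      refine integral_congr_ae (ae_of_all _ fun x => ?_)
      simp only [A, indicator]; split_ifs <;> simp
    have q1 : ∫ x, B₁ x * φ x ∂unitVolume = w⁻¹ * ∫ x in a..t, (x - a) * φ x := by
      rw [← intervalIntegral.integral_const_mul, ← hind haI htI hat]
      refine integral_congr_ae (ae_of_all _ fun x => ?_)
      simp only [B₁, indicator]; split_ifs <;> simp [mul_assoc]
    have q2 : ∫ x, B₂ x * φ x ∂unitVolume = w⁻¹ * ∫ x in t..b, (x - b) * φ x := by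
      rw [← intervalIntegral.integral_const_mul, ← hind htI hbI htb]
      refine integral_congr_ae (ae_of_all _ fun x => ?_)
      simp only [B₂, indicator]; split_ifs <;> simp [mul_assoc]
    have q3 : ∫ x, (B₁ x + B₂ x) * φ x ∂unitVolume =
        ∫ x, B₁ x * φ x ∂unitVolume + ∫ x, B₂ x * φ x ∂unitVolume := by
      have i1 : Integrable (fun x => B₁ x * φ x) unitVolume := hB₁.integrable_mul h.memLp
      have i2 : Integrable (fun x => B₂ x * φ x) unitVolume := hB₂.integrable_mul h.memLp
      rw [← integral_add i1 i2]
      simp only [add_mul]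
    rw [q3, q0, q1, q2, ← intervalIntegral.integral_add_adjacent_intervals (hg haI htI) (hg htI hbI),
      ← mul_add, ← mul_add, eq_inv_mul_iff_mul_eq₀ hw.ne']
    linear_combination p1 + p2 + g t * hb

/-! ### Iterated primitives and their evaluation functionals. -/

/-- The `k`-fold iterated primitive of `φ` with integration constants `c`. -/
def iterPrim (c : ℕ → ℝ) (φ : ℝ → ℝ) : ℕ → ℝ → ℝ
  | 0 => φ
  | k + 1 => fun x => c k + ∫ s in (0 : ℝ)..x, iterPrim c φ k s

section IterPrim

variable {φ ξ : ℝ → ℝ} {c d : ℕ → ℝ}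

theorem isL2Primitive_iterPrim_of_memLp {k : ℕ} (h : MemLp (iterPrim c φ k) 2 unitVolume) :
    IsL2Primitive (iterPrim c φ (k + 1)) (iterPrim c φ k) :=
  ⟨h, fun x _ => by simp [iterPrim]⟩

theorem memLp_iterPrim (hφ : MemLp φ 2 unitVolume) (k : ℕ) :
    MemLp (iterPrim c φ k) 2 unitVolume := by
  induction k with
  | zero => exact hφ
  | succ k ih => exact (isL2Primitive_iterPrim_of_memLp ih).memLp_self

theorem isL2Primitive_iterPrim (hφ : MemLp φ 2 unitVolume) (k : ℕ) :
    IsL2Primitive (iterPrim c φ (k + 1)) (iterPrim c φ k) :=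
  isL2Primitive_iterPrim_of_memLp (memLp_iterPrim hφ k)

theorem tower_iterPrim (hφ : MemLp φ 2 unitVolume) (m : ℕ) : ∀ j < m,
    IsL2Primitive (iterPrim c φ (m - j)) (iterPrim c φ (m - (j + 1))) := by
  intro j hj
  obtain ⟨k, hk⟩ : ∃ k, m - j = k + 1 := ⟨m - (j + 1), by omega⟩
  rw [hk, show m - (j + 1) = k by omega]
  exact isL2Primitive_iterPrim hφ k

theorem memSobolev_iterPrim {m : ℕ} (hm : 1 ≤ m) (hφ : MemLp φ 2 unitVolume) :
    MemSobolev m (iterPrim c φ m) :=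
  memSobolev_of_tower (F := fun j => iterPrim c φ (m - j)) hm (tower_iterPrim hφ m)

theorem derivUnit_iterPrim {m : ℕ} (hm : 1 ≤ m) (hφ : MemLp φ 2 unitVolume) :
    derivUnit m (iterPrim c φ m) =ᵐ[unitVolume] φ := by
  have := derivUnit_ae_of_tower (F := fun j => iterPrim c φ (m - j)) hm (tower_iterPrim hφ m)
  simpa [iterPrim] using this

theorem iterPrim_add_const_mul (hφ : MemLp φ 2 unitVolume) (hξ : MemLp ξ 2 unitVolume) (a : ℝ)
    (k : ℕ) : EqOn (iterPrim (fun j => c j + a * d j) (fun x => φ x + a * ξ x) k)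
      (fun x => iterPrim c φ k x + a * iterPrim d ξ k x) (Icc 0 1) := by
  induction k with
  | zero => exact fun x _ => rfl
  | succ k ih =>
    intro x hx
    have i1 := (isL2Primitive_iterPrim (c := c) hφ k).intervalIntegrable (a := 0) (by simp) hx
    have i2 := (isL2Primitive_iterPrim (c := d) hξ k).intervalIntegrable (a := 0) (by simp) hx
    simp only [iterPrim]
    have e := intervalIntegral.integral_congr (μ := volume) (a := 0) (b := x)
      (ih.mono (uIcc_subset_Icc (by simp) hx))
    rw [e, intervalIntegral.integral_add i1 (i2.const_mul a), intervalIntegral.integral_const_mul]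
    ring

/-- One integration makes point values independent of the representative, which lets evaluation act
on `Lp` classes. -/
theorem iterPrim_congr_ae (h : φ =ᵐ[unitVolume] ξ) (k : ℕ) :
    iterPrim c φ k =ᵐ[unitVolume] iterPrim c ξ k ∧
      EqOn (iterPrim c φ (k + 1)) (iterPrim c ξ (k + 1)) (Icc 0 1) := by
  have step : ∀ k, iterPrim c φ k =ᵐ[unitVolume] iterPrim c ξ k →
      EqOn (iterPrim c φ (k + 1)) (iterPrim c ξ (k + 1)) (Icc 0 1) := by
    intro k hk x hx
    simp only [iterPrim]
    congr 1
    refine intervalIntegral.integral_congr_ae ?_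
    filter_upwards [ae_unitVolume_iff.1 hk] with y hy hy'
    rw [uIoc_of_le hx.1] at hy'
    exact hy ⟨hy'.1.le, hy'.2.trans hx.2⟩
  induction k with
  | zero => exact ⟨h, step 0 h⟩
  | succ k ih =>
    have h1 : iterPrim c φ (k + 1) =ᵐ[unitVolume] iterPrim c ξ (k + 1) :=
      ae_unitVolume_iff.2 (ae_of_all _ ih.2)
    exact ⟨h1, step _ h1⟩

theorem abs_integral_le_of_abs_le {f : ℝ → ℝ} {C x : ℝ} (hx : x ∈ Icc (0 : ℝ) 1) (hC : 0 ≤ C)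
    (hf : ∀ y ∈ Icc (0 : ℝ) 1, |f y| ≤ C) : |∫ s in (0 : ℝ)..x, f s| ≤ C := by
  have := intervalIntegral.norm_integral_le_of_norm_le_const (a := 0) (b := x) (f := f) (C := C)
    fun y hy => by
      rw [uIoc_of_le hx.1] at hy
      exact hf y ⟨hy.1.le, hy.2.trans hx.2⟩
  rw [Real.norm_eq_abs, sub_zero, abs_of_nonneg hx.1] at this
  exact this.trans (mul_le_of_le_one_right hC hx.2)

theorem abs_iterPrim_le (hφ : MemLp φ 2 unitVolume) (k : ℕ) : ∀ x ∈ Icc (0 : ℝ) 1,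
    |iterPrim (fun _ => 0) φ (k + 1) x| ≤ √(sqNormL2 φ) := by
  induction k with
  | zero =>
    intro x hx
    simp only [iterPrim, zero_add]
    have h1 : |∫ s in (0 : ℝ)..x, φ s| ≤ ∫ s in uIoc 0 x, |φ s| := by
      simpa using intervalIntegral.norm_integral_le_integral_norm_uIoc
        (f := φ) (a := 0) (b := x) (μ := volume)
    have h2 : ∫ s in uIoc 0 x, |φ s| ≤ ∫ s in Icc 0 1, |φ s| := by
      refine setIntegral_mono_set hφ.integrable_unit.abs (ae_of_all _ fun s => abs_nonneg _) ?_
      exact (uIoc_subset_uIcc.trans (uIcc_subset_Icc (by simp) hx)).eventuallyLE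
    have h3 := integral_abs_mul_le (memLp_const (1 : ℝ)) hφ
    have h4 : sqNormL2 (fun _ => (1 : ℝ)) = 1 := by simp [sqNormL2]
    simp only [one_mul, h4, Real.sqrt_one] at h3
    exact (h1.trans h2).trans h3
  | succ k ih =>
    intro x hx
    rw [iterPrim]
    simp only [zero_add]
    exact abs_integral_le_of_abs_le hx (Real.sqrt_nonneg _) ih

theorem iterPrim_eq_add (hφ : MemLp φ 2 unitVolume) (k : ℕ) {x : ℝ} (hx : x ∈ Icc (0 : ℝ) 1) :
    iterPrim c φ k x = iterPrim c (fun _ => 0) k x + iterPrim (fun _ => 0) φ k x := by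
  have := iterPrim_add_const_mul (c := c) (d := fun _ => 0) (memLp_const (0 : ℝ)) hφ 1 k hx
  simpa using this

/-- Riesz representation of the evaluation of an iterated primitive. -/
theorem exists_inner_eq_iterPrim {m : ℕ} (hm : 1 ≤ m) {t : ℝ} (ht : t ∈ Icc (0 : ℝ) 1) :
    ∃ k : Lp ℝ 2 unitVolume, ∀ (φ : ℝ → ℝ) (hφ : MemLp φ 2 unitVolume),
      inner ℝ k (hφ.toLp φ) = iterPrim (fun _ => 0) φ m t := by
  obtain ⟨n, rfl⟩ : ∃ n, m = n + 1 := ⟨m - 1, by omega⟩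
  let Λ : Lp ℝ 2 unitVolume →ₗ[ℝ] ℝ := IsLinearMap.mk'
    (fun φ => iterPrim (fun _ => 0) φ (n + 1) t) <| by
      have key : ∀ (φ ξ : Lp ℝ 2 unitVolume) (a : ℝ),
          iterPrim (fun _ => 0) (φ + a • ξ : Lp ℝ 2 unitVolume) (n + 1) t =
          iterPrim (fun _ => 0) φ (n + 1) t + a * iterPrim (fun _ => 0) ξ (n + 1) t := by
        intro φ ξ a
        have h1 : ((φ + a • ξ : Lp ℝ 2 unitVolume) : ℝ → ℝ) =ᵐ[unitVolume]
            fun x => φ x + a * ξ x := by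
          filter_upwards [Lp.coeFn_add φ (a • ξ), Lp.coeFn_smul a ξ] with x h1 h2
          rw [h1, Pi.add_apply, h2]; rfl
        rw [(iterPrim_congr_ae h1 n).2 ht]
        have := iterPrim_add_const_mul (c := fun _ => 0) (d := fun _ => 0)
          (Lp.memLp φ) (Lp.memLp ξ) a (n + 1) ht
        simpa using this
      refine ⟨fun φ ξ => ?_, fun a φ => ?_⟩
      · simpa using key φ ξ 1
      · have h0 := key 0 0 (-1)
        have h1 := key 0 φ a
        simp only [smul_zero, add_zero, zero_add, neg_mul, one_mul, add_neg_cancel] at h0 h1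
        rw [h1, h0, zero_add, smul_eq_mul]
  have hb : ∀ φ : Lp ℝ 2 unitVolume, ‖Λ φ‖ ≤ 1 * ‖φ‖ := fun φ => by
    have h1 := abs_iterPrim_le (Lp.memLp φ) n t ht
    rw [← norm_toLp_unit (Lp.memLp φ), Lp.toLp_coeFn] at h1
    simpa [Λ] using h1
  refine ⟨(InnerProductSpace.toDual ℝ _).symm (Λ.mkContinuous 1 hb), fun φ hφ => ?_⟩
  rw [InnerProductSpace.toDual_symm_apply]
  change iterPrim (fun _ => 0) (hφ.toLp φ) (n + 1) t = _
  exact (iterPrim_congr_ae hφ.coeFn_toLp n).2 ht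

end IterPrim

/-- Taylor's formula at `0` with integral remainder; the integration constants are the derivatives
at `0`, highest order first. -/
theorem MemSobolev.exists_eqOn_iterPrim {m : ℕ} (hm : 1 ≤ m) {f : ℝ → ℝ} (hf : MemSobolev m f) :
    ∃ c : ℕ → ℝ, EqOn f (iterPrim c (derivUnit m f) m) (Icc 0 1) := by
  let c : ℕ → ℝ := fun k => derivUnit (m - 1 - k) f 0
  have key : ∀ k ≤ m, EqOn (derivUnit (m - k) f) (iterPrim c (derivUnit m f) k) (Icc 0 1) := by
    intro k
    induction k with
    | zero => intro _ x _; rfl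
    | succ k ih =>
      intro hk x hx
      have h1 := hf.isL2Primitive hm (j := m - (k + 1)) (by omega)
      rw [show m - (k + 1) + 1 = m - k by omega] at h1
      rw [h1.eq_integral x hx, iterPrim]
      congr 1
      · simp only [c]; rw [show m - (k + 1) = m - 1 - k by omega]
      · exact intervalIntegral.integral_congr ((ih (by omega)).mono
          (uIcc_subset_Icc (by simp) hx))
  refine ⟨c, ?_⟩
  have := key m le_rfl
  rwa [Nat.sub_self, derivUnit_zero] at this

/-! ### Existence of a minimizer. -/

/-- A convex function lies above its tangents: the one at `x₁` controls the left half line, the one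
at `x₂` the right. -/
theorem exists_mul_abs_sub_le {ρ ψ : ℝ → ℝ} (hρ : ConvexOn ℝ univ ρ)
    (hψ : ∀ x, HasDerivAt ρ (ψ x) x) {x₁ x₂ : ℝ} (h₁ : ψ x₁ < 0) (h₂ : 0 < ψ x₂) :
    ∃ a b : ℝ, 0 < a ∧ ∀ x, a * |x| - b ≤ ρ x := by
  have tang : ∀ y x, ρ y + ψ y * (x - y) ≤ ρ x := by
    intro y x
    rcases lt_trichotomy x y with h | rfl | h
    · have := hρ.slope_le_of_hasDerivAt (mem_univ x) (mem_univ y) h (hψ y)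
      rw [slope_def_field, div_le_iff₀ (by linarith)] at this
      linarith
    · simp
    · have := hρ.le_slope_of_hasDerivAt (mem_univ y) (mem_univ x) h (hψ y)
      rw [slope_def_field, le_div_iff₀ (by linarith)] at this
      linarith
  set a := min (-ψ x₁) (ψ x₂) with ha
  have ha0 : 0 < a := lt_min (by linarith) h₂
  refine ⟨a, |ρ x₁ - ψ x₁ * x₁| + |ρ x₂ - ψ x₂ * x₂|, ha0, fun x => ?_⟩
  have n1 := neg_abs_le (ρ x₁ - ψ x₁ * x₁)
  have n2 := neg_abs_le (ρ x₂ - ψ x₂ * x₂)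
  have n3 := abs_nonneg (ρ x₁ - ψ x₁ * x₁)
  have n4 := abs_nonneg (ρ x₂ - ψ x₂ * x₂)
  rcases le_total 0 x with hx | hx
  · rw [abs_of_nonneg hx]
    have := mul_le_mul_of_nonneg_right (min_le_right (-ψ x₁) (ψ x₂)) hx
    linarith [tang x₂ x]
  · rw [abs_of_nonpos hx]
    have := mul_le_mul_of_nonneg_right (min_le_left (-ψ x₁) (ψ x₂)) (neg_nonneg.2 hx)
    linarith [tang x₁ x]

/-- The objective sees only the values at the design points and `f^{(m)}`. Projecting `f^{(m)}` onto
the span `K` of the representers `k i` keeps the values and does not increase the penalty, so a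
finite dimensional problem remains, whose sublevel sets are bounded by the linear growth of `ρ`. -/
theorem exists_isMTypeSpline {m : ℕ} (hm : 1 ≤ m) {ρ : ℝ → ℝ} (hρ : Continuous ρ) {a b : ℝ}
    (ha : 0 < a) (hab : ∀ x, a * |x| - b ≤ ρ x) {lam s : ℝ} (hlam : 0 < lam) (hs : 0 < s) {n : ℕ}
    (hn : 1 ≤ n) {t : Fin n → ℝ} (ht : ∀ i, t i ∈ Icc (0 : ℝ) 1) (Y : Fin n → ℝ) :
    ∃ f, IsMTypeSpline m ρ lam s t Y f := by
  choose k hk using fun i => exists_inner_eq_iterPrim hm (ht i)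
  let K : Submodule ℝ (Lp ℝ 2 unitVolume) := Submodule.span ℝ (range k)
  have : FiniteDimensional ℝ K := FiniteDimensional.span_of_finite ℝ (finite_range k)
  have : ProperSpace K := FiniteDimensional.proper_real K
  have hkK : ∀ i, k i ∈ K := fun i => Submodule.subset_span (mem_range_self i)
  -- The unknown is the vector of fitted values, not the polynomial coefficients `c`: with few
  -- distinct design points the values do not determine the polynomial, and coercivity in `c` would
  -- fail.
  let R : Submodule ℝ ((Fin n → ℝ) × K) :=
    { carrier := {p | ∃ c : ℕ → ℝ, ∀ i, p.1 i =
        iterPrim c (fun _ => 0) m (t i) + inner ℝ (k i) (p.2 : Lp ℝ 2 unitVolume)}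
      add_mem' := by
        rintro p q ⟨c, hc⟩ ⟨d, hd⟩
        refine ⟨fun j => c j + 1 * d j, fun i => ?_⟩
        have := iterPrim_add_const_mul (c := c) (d := d) (memLp_const (0 : ℝ))
          (memLp_const (0 : ℝ)) 1 m (ht i)
        simp only [mul_zero, add_zero] at this
        rw [this]
        simp only [Prod.fst_add, Prod.snd_add, Pi.add_apply, hc, hd, Submodule.coe_add,
          inner_add_right]
        ring
      zero_mem' := by
        refine ⟨fun _ => 0, fun i => ?_⟩
        have := iterPrim_add_const_mul (c := fun _ => 0) (d := fun _ => 0) (memLp_const (0 : ℝ))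
          (memLp_const (0 : ℝ)) (-1) m (ht i)
        simp only [mul_zero, add_zero, neg_mul, one_mul, add_neg_cancel] at this
        rw [this]
        simp
      smul_mem' := by
        rintro r p ⟨c, hc⟩
        refine ⟨fun j => c j + (r - 1) * c j, fun i => ?_⟩
        have := iterPrim_add_const_mul (c := c) (d := c) (memLp_const (0 : ℝ))
          (memLp_const (0 : ℝ)) (r - 1) m (ht i)
        simp only [mul_zero, add_zero] at this
        rw [this]
        simp only [Prod.smul_fst, Prod.smul_snd, Pi.smul_apply, hc, Submodule.coe_smul,
          inner_smul_right, smul_eq_mul]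
        ring }
  let G : (Fin n → ℝ) × K → ℝ := fun p =>
    (1 / (n : ℝ)) * ∑ i, ρ ((Y i - p.1 i) / s) + lam * ‖p.2‖ ^ 2
  have hG : Continuous G := by fun_prop
  have hn0 : (0 : ℝ) < n := by exact_mod_cast hn
  have hbdd : Bornology.IsBounded {p | G p ≤ G 0} := by
    have hlow : ∀ x, -b ≤ ρ x := fun x => by
      have := mul_nonneg ha.le (abs_nonneg x); linarith [hab x]
    have h1 : ∀ p i, G p ≤ G 0 → |p.1 i| ≤ |Y i| + s * ((n * G 0 + n * b) / a) := by
      intro p i hp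
      have hsum : a * |(Y i - p.1 i) / s| - b + (n - 1) * (-b) ≤
          ∑ i, ρ ((Y i - p.1 i) / s) := by
        rw [← Finset.add_sum_erase _ _ (Finset.mem_univ i)]
        refine add_le_add (hab _) ?_
        have := Finset.card_nsmul_le_sum (Finset.univ.erase i) (fun j => ρ ((Y j - p.1 j) / s)) (-b)
          fun j _ => hlow _
        rw [Finset.card_erase_of_mem (Finset.mem_univ i), Finset.card_univ, Fintype.card_fin,
          nsmul_eq_mul, Nat.cast_sub hn, Nat.cast_one] at this
        exact this
      have h2 : (1 / (n : ℝ)) * ∑ i, ρ ((Y i - p.1 i) / s) ≤ G 0 := by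
        have : 0 ≤ lam * ‖p.2‖ ^ 2 := by positivity
        have : (1 / (n : ℝ)) * ∑ i, ρ ((Y i - p.1 i) / s) + lam * ‖p.2‖ ^ 2 ≤ G 0 := hp
        linarith
      rw [one_div, inv_mul_le_iff₀ hn0] at h2
      have h3 : |(Y i - p.1 i) / s| ≤ (n * G 0 + n * b) / a := by
        rw [le_div_iff₀ ha]; linarith
      rw [abs_div, abs_of_pos hs, div_le_iff₀ hs] at h3
      have := abs_sub_abs_le_abs_sub (p.1 i) (Y i)
      rw [abs_sub_comm] at this
      linarith
    have h2 : ∀ p, G p ≤ G 0 → ‖p.2‖ ≤ 1 + (G 0 + b) / lam := by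
      intro p hp
      have hsum : n * (-b) ≤ ∑ i, ρ ((Y i - p.1 i) / s) := by
        have := Finset.card_nsmul_le_sum Finset.univ (fun j => ρ ((Y j - p.1 j) / s)) (-b)
          fun j _ => hlow _
        rwa [Finset.card_univ, Fintype.card_fin, nsmul_eq_mul] at this
      have h3 : -b ≤ (1 / (n : ℝ)) * ∑ i, ρ ((Y i - p.1 i) / s) := by
        rw [one_div, le_inv_mul_iff₀ hn0]; exact hsum
      have h4 : (1 / (n : ℝ)) * ∑ i, ρ ((Y i - p.1 i) / s) + lam * ‖p.2‖ ^ 2 ≤ G 0 := hp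
      have h5 : ‖p.2‖ ^ 2 ≤ (G 0 + b) / lam := by
        rw [le_div_iff₀ hlam]; linarith
      nlinarith [sq_nonneg (‖p.2‖ - 1)]
    let M : ℝ := ∑ i, (|Y i| + s * |(n * G 0 + n * b) / a|)
    refine (Metric.isBounded_closedBall (x := (0 : (Fin n → ℝ) × K))
      (r := max M (1 + (G 0 + b) / lam))).subset fun p hp => ?_
    rw [mem_closedBall_zero_iff, Prod.norm_def]
    refine max_le_max ?_ (h2 p hp)
    rw [pi_norm_le_iff_of_nonneg (Finset.sum_nonneg fun i _ => by positivity)]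
    intro i
    refine ((h1 p i hp).trans ?_).trans (Finset.single_le_sum
      (f := fun i => |Y i| + s * |(n * G 0 + n * b) / a|) (fun i _ => by positivity)
      (Finset.mem_univ i))
    gcongr
    exact le_abs_self _
  have hcomp : IsCompact ((R : Set ((Fin n → ℝ) × K)) ∩ {p | G p ≤ G 0}) :=
    Metric.isCompact_of_isClosed_isBounded
      (R.closed_of_finiteDimensional.inter (isClosed_le hG continuous_const))
      (hbdd.subset inter_subset_right)
  obtain ⟨p, ⟨hpR, hp0⟩, hmin⟩ := hcomp.exists_isMinOn ⟨0, R.zero_mem, le_refl (G 0)⟩ hG.continuousOn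
  have hmin' : ∀ q ∈ R, G p ≤ G q := fun q hq => by
    by_cases h : G q ≤ G 0
    · exact hmin ⟨hq, h⟩
    · exact (le_trans hp0 (not_le.1 h).le)
  obtain ⟨c, hc⟩ := hpR
  have hκ := Lp.memLp (p.2 : Lp ℝ 2 unitVolume)
  refine ⟨iterPrim c (p.2 : Lp ℝ 2 unitVolume) m, memSobolev_iterPrim hm hκ, fun g hg => ?_⟩
  have e1 : splineObjective m ρ lam s t Y (iterPrim c (p.2 : Lp ℝ 2 unitVolume) m) = G p := by
    simp only [splineObjective, G]
    congr 2
    · refine Finset.sum_congr rfl fun i _ => ?_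
      rw [iterPrim_eq_add hκ m (ht i), hc i, ← hk i _ hκ, Lp.toLp_coeFn]
    · rw [sqNormL2_congr (derivUnit_iterPrim hm hκ), ← norm_toLp_unit_sq hκ, Lp.toLp_coeFn]
      rfl
  rw [e1]
  obtain ⟨d, hd⟩ := hg.exists_eqOn_iterPrim hm
  have hξ := hg.memLp
  let q : (Fin n → ℝ) × K := (fun i => g (t i), K.orthogonalProjectionOnto (hξ.toLp _))
  have hqR : q ∈ R := by
    refine ⟨d, fun i => ?_⟩
    have : inner ℝ (k i) ((K.orthogonalProjectionOnto (hξ.toLp _) : K) : Lp ℝ 2 unitVolume) =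
        inner ℝ (k i) (hξ.toLp _) :=
      K.inner_orthogonalProjectionOnto_eq_of_mem_left ⟨k i, hkK i⟩ (hξ.toLp _)
    simp only [q]
    rw [this, hk i _ hξ, hd (ht i), iterPrim_eq_add hξ m (ht i)]
  refine (hmin' q hqR).trans ?_
  simp only [G, splineObjective, q]
  gcongr
  rw [← norm_toLp_unit_sq hξ]
  gcongr
  exact K.norm_orthogonalProjectionOnto_apply_le _

/-! ### Moments of the errors. -/

section Moments

variable {Ω : Type*} [MeasurableSpace Ω] {μ : Measure Ω}

/-- If `ψ` had constant sign, zero mean would force `ψ(X) = 0` almost surely; such zeros are extrema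
of `ψ`, so `ψ'(X)` would vanish as well. -/
theorem exists_neg_and_pos [IsProbabilityMeasure μ] {X : Ω → ℝ} {ψ : ℝ → ℝ}
    (hint : Integrable (fun ω => ψ (X ω)) μ)
    (hmean : ∫ ω, ψ (X ω) ∂μ = 0) (hpos : 0 < ∫ ω, deriv ψ (X ω) ∂μ) :
    (∃ x, ψ x < 0) ∧ ∃ x, 0 < ψ x := by
  have key : (∀ᵐ ω ∂μ, ψ (X ω) = 0) → (∀ x, ψ x = 0 → deriv ψ x = 0) → False := by
    intro h1 h2
    have : ∫ ω, deriv ψ (X ω) ∂μ = 0 :=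
      integral_eq_zero_of_ae (h1.mono fun ω hω => h2 _ hω)
    linarith
  constructor
  · by_contra! H
    refine key ((integral_eq_zero_iff_of_nonneg (fun ω => H _) hint).1 hmean) fun x hx => ?_
    exact IsLocalMin.deriv_eq_zero (Eventually.of_forall fun y => by rw [hx]; exact H y)
  · by_contra! H
    have h0 : ∫ ω, -ψ (X ω) ∂μ = 0 := by rw [integral_neg, hmean, neg_zero]
    have h1 := (integral_eq_zero_iff_of_nonneg (fun ω => neg_nonneg.2 (H _)) hint.neg).1 h0
    refine key (h1.mono fun ω hω => by simpa using hω) fun x hx => ?_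
    exact IsLocalMax.deriv_eq_zero (Eventually.of_forall fun y => by rw [hx]; exact H y)

/-- A sequence of centred, uncorrelated, square integrable variables of constant variance `V`. -/
structure IsWhiteNoise (μ : Measure Ω) (w : ℕ → Ω → ℝ) (V : ℝ) : Prop where
  memLp : ∀ i, MemLp (w i) 2 μ
  integral_mul : ∀ i j, i ≠ j → ∫ ω, w i ω * w j ω ∂μ = 0
  integral_sq : ∀ i, ∫ ω, w i ω ^ 2 ∂μ = V

theorem isWhiteNoise_comp {ε : ℕ → Ω → ℝ}
    (hε_meas : ∀ i, Measurable (ε i)) (hε_indep : iIndepFun ε μ)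
    (hε_ident : ∀ i, IdentDistrib (ε i) (ε 0) μ μ) {f : ℝ → ℝ} (hf : Measurable f)
    (hL : MemLp (fun ω => f (ε 0 ω)) 2 μ) (hmean : ∫ ω, f (ε 0 ω) ∂μ = 0) :
    IsWhiteNoise μ (fun i ω => f (ε i ω)) (∫ ω, f (ε 0 ω) ^ 2 ∂μ) := by
  have hid : ∀ i, IdentDistrib (fun ω => f (ε i ω)) (fun ω => f (ε 0 ω)) μ μ :=
    fun i => (hε_ident i).comp hf
  refine ⟨fun i => (hid i).memLp_iff.2 hL, fun i j hij => ?_, fun i => ?_⟩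
  · have h1 := (hε_indep.comp (fun _ => f) fun _ => hf).indepFun hij
    have h2 := h1.integral_fun_mul_eq_mul_integral
      (hf.comp (hε_meas i)).aestronglyMeasurable (hf.comp (hε_meas j)).aestronglyMeasurable
    have h3 := (hid i).integral_eq
    simp only [Function.comp] at h2
    rw [h2, h3, hmean, zero_mul]
  · exact ((hid i).comp (measurable_id.pow_const 2)).integral_eq

theorem IsWhiteNoise.nonneg {w : ℕ → Ω → ℝ} {V : ℝ} (hw : IsWhiteNoise μ w V) : 0 ≤ V := by
  rw [← hw.integral_sq 0]
  exact integral_nonneg fun _ => sq_nonneg _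

section SecondMoment

variable {H : Type*} [NormedAddCommGroup H] [InnerProductSpace ℝ H] {w : ℕ → Ω → ℝ} {V : ℝ}

theorem norm_sum_smul_sq {n : ℕ} (x : Fin n → ℝ) (v : Fin n → H) :
    ‖∑ i, x i • v i‖ ^ 2 = ∑ i, ∑ j, x i * x j * inner ℝ (v i) (v j) := by
  rw [← real_inner_self_eq_norm_sq, sum_inner]
  refine Finset.sum_congr rfl fun i _ => ?_
  rw [inner_sum]
  refine Finset.sum_congr rfl fun j _ => ?_
  rw [real_inner_smul_left, real_inner_smul_right]
  ring

theorem IsWhiteNoise.integrable_mul (hw : IsWhiteNoise μ w V) (i j : ℕ) :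
    Integrable (fun ω => w i ω * w j ω) μ := (hw.memLp i).integrable_mul (hw.memLp j)

theorem IsWhiteNoise.integrable_norm_sq (hw : IsWhiteNoise μ w V) {n : ℕ} (v : Fin n → H) :
    Integrable (fun ω => ‖∑ i : Fin n, w i ω • v i‖ ^ 2) μ := by
  simp only [norm_sum_smul_sq]
  exact integrable_finsetSum _ fun i _ => integrable_finsetSum _ fun j _ =>
    (hw.integrable_mul i j).mul_const _

theorem IsWhiteNoise.integral_norm_sq_le (hw : IsWhiteNoise μ w V) {n : ℕ} (v : Fin n → H) {c : ℝ}
    (hv : ∀ i, ‖v i‖ ^ 2 ≤ c) :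
    ∫ ω, ‖∑ i : Fin n, w i ω • v i‖ ^ 2 ∂μ ≤ n * (V * c) := by
  simp only [norm_sum_smul_sq]
  have hint : ∀ i j : Fin n,
      Integrable (fun ω => w i ω * w j ω * (inner ℝ (v i) (v j) : ℝ)) μ :=
    fun i j => (hw.integrable_mul i j).mul_const _
  rw [integral_finsetSum _ fun i _ => integrable_finsetSum _ fun j _ => hint i j]
  have : ∀ i : Fin n, ∫ ω, ∑ j : Fin n, w i ω * w j ω * inner ℝ (v i) (v j) ∂μ ≤ V * c := by
    intro i
    rw [integral_finsetSum _ fun j _ => hint i j, Finset.sum_eq_single i]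
    · rw [integral_mul_const, real_inner_self_eq_norm_sq]
      simp only [← sq]
      rw [hw.integral_sq]
      exact mul_le_mul_of_nonneg_left (hv i) hw.nonneg
    · intro j _ hj
      rw [integral_mul_const, hw.integral_mul _ _ (fun h => hj (Fin.ext h).symm), zero_mul]
    · simp
  refine (Finset.sum_le_sum fun i _ => this i).trans ?_
  simp

end SecondMoment

theorem measure_lt_le_of_integral_le [IsFiniteMeasure μ] {Q : Ω → ℝ} (hQ : Integrable Q μ)
    (h0 : ∀ ω, 0 ≤ Q ω) {a b δ : ℝ} (hab : ∫ ω, Q ω ∂μ ≤ a) (hb : 0 < b) (hδ : a ≤ b * δ) :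
    μ {ω | b < Q ω} ≤ ENNReal.ofReal δ := by
  have h1 := mul_meas_ge_le_integral_of_nonneg (ae_of_all _ h0) hQ b
  have h2 : μ.real {ω | b ≤ Q ω} ≤ δ := le_of_mul_le_mul_left (by linarith) hb
  calc μ {ω | b < Q ω} ≤ μ {ω | b ≤ Q ω} := measure_mono fun ω (hω : b < Q ω) => hω.le
    _ = ENNReal.ofReal (μ.real {ω | b ≤ Q ω}) := (ofReal_measureReal).symm
    _ ≤ ENNReal.ofReal δ := ENNReal.ofReal_le_ofReal h2

end Moments

/-! ### Uniform bounds for linear empirical functionals. -/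

/-- The weighted empirical functional `g ↦ n⁻¹ ∑ wᵢ g(tᵢ)` is bounded by `√(c / (n h))` for the
Sobolev norm of order one and bandwidth `h`. -/
def EmpiricalBound (c h : ℝ) {n : ℕ} (t w : Fin n → ℝ) : Prop :=
  ∀ g φ : ℝ → ℝ, IsL2Primitive g φ →
    ((1 / (n : ℝ)) * ∑ i, w i * g (t i)) ^ 2 ≤
      c / (n * h) * (sqNormL2 g + h ^ 2 * sqNormL2 φ)

theorem EmpiricalBound.mono {c d h : ℝ} (hh : 0 ≤ h) {n : ℕ} {t w : Fin n → ℝ}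
    (H : EmpiricalBound c h t w) (hcd : c ≤ d) : EmpiricalBound d h t w := fun g φ hg => by
  refine (H g φ hg).trans (mul_le_mul_of_nonneg_right (by gcongr) ?_)
  have := sqNormL2_nonneg g
  have := sqNormL2_nonneg φ
  positivity

/-- With `a = ∑ wᵢ Aᵢ` and `b = ∑ wᵢ Bᵢ` in `L²`, the sum is `⟨a, g⟩ + ⟨b, φ⟩`. Cauchy-Schwarz gives
the factor `‖a‖² + h⁻²‖b‖²`, free of `g`, with mean at most `2nV/h`; Markov's inequality finishes.
-/
theorem measure_not_empiricalBound_le {Ω : Type*} [MeasurableSpace Ω] {μ : Measure Ω}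
    [IsFiniteMeasure μ] {w : ℕ → Ω → ℝ} {V : ℝ} (hw : IsWhiteNoise μ w V) {δ : ℝ} (hδ : 0 < δ)
    {n : ℕ} (hn : 1 ≤ n) {h : ℝ} (hh : 0 < h) (hh1 : h ≤ 1) {t : Fin n → ℝ}
    (ht : ∀ i, t i ∈ Icc (0 : ℝ) 1) :
    μ {ω | ¬ EmpiricalBound ((2 * V + 1) / δ) h t (fun i => w i ω)} ≤ ENNReal.ofReal δ := by
  choose A B hA hB hA' hB' hAB using fun i => exists_kernels (ht i) hh hh1
  have hn0 : (0 : ℝ) < n := by exact_mod_cast hn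
  have hV := hw.nonneg
  let Q : Ω → ℝ := fun ω => ‖∑ i : Fin n, w i ω • (hA i).toLp (A i)‖ ^ 2 +
    (h ^ 2)⁻¹ * ‖∑ i : Fin n, w i ω • (hB i).toLp (B i)‖ ^ 2
  have i1 := hw.integrable_norm_sq fun i => (hA i).toLp (A i)
  have i2 := (hw.integrable_norm_sq fun i => (hB i).toLp (B i)).const_mul (h ^ 2)⁻¹
  have hQint : ∫ ω, Q ω ∂μ ≤ n * (2 * V) / h := by
    have e1 := hw.integral_norm_sq_le (fun i => (hA i).toLp (A i)) (c := h⁻¹)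
      fun i => by rw [norm_toLp_unit_sq]; exact hA' i
    have e2 := hw.integral_norm_sq_le (fun i => (hB i).toLp (B i)) (c := h)
      fun i => by rw [norm_toLp_unit_sq]; exact hB' i
    simp only [Q]
    rw [integral_add i1 i2, integral_const_mul]
    have e3 := mul_le_mul_of_nonneg_left e2 (inv_nonneg.2 (sq_nonneg h))
    refine (add_le_add e1 e3).trans (le_of_eq ?_)
    field_simp; ring
  refine le_trans (measure_mono ?_) (measure_lt_le_of_integral_le (i1.add i2)
    (fun ω => by simp only [Pi.add_apply]; positivity) hQint
    -- The summand `1` keeps the threshold positive when `V = 0`.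
    (b := n * ((2 * V + 1) / δ) / h) (δ := δ) (by positivity) ?_)
  · intro ω hω
    by_contra hcon
    refine hω fun g φ hg => ?_
    simp only [Pi.add_apply, mem_ofPred_eq, not_lt] at hcon
    set a := ∑ i : Fin n, w i ω • (hA i).toLp (A i)
    set b := ∑ i : Fin n, w i ω • (hB i).toLp (B i)
    set G := hg.memLp_self.toLp g
    set P := hg.memLp.toLp φ
    have e : ∑ i : Fin n, w i ω * g (t i) = inner ℝ a G + inner ℝ b P := by
      rw [sum_inner, sum_inner, ← Finset.sum_add_distrib]
      refine Finset.sum_congr rfl fun i _ => ?_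
      rw [real_inner_smul_left, real_inner_smul_left, inner_toLp_unit (hA i) hg.memLp_self,
        inner_toLp_unit (hB i) hg.memLp, ← mul_add, hAB i g φ hg]
    have c1 := abs_real_inner_le_norm a G
    have c2 := abs_real_inner_le_norm b P
    have cs : (∑ i : Fin n, w i ω * g (t i)) ^ 2 ≤
        (‖a‖ ^ 2 + (h ^ 2)⁻¹ * ‖b‖ ^ 2) * (‖G‖ ^ 2 + h ^ 2 * ‖P‖ ^ 2) := by
      have l1 : |∑ i : Fin n, w i ω * g (t i)| ≤ ‖a‖ * ‖G‖ + ‖b‖ * ‖P‖ := by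
        rw [e]; exact (abs_add_le _ _).trans (add_le_add c1 c2)
      have l2 := pow_le_pow_left₀ (abs_nonneg _) l1 2
      rw [sq_abs] at l2
      refine l2.trans ?_
      have h1 : (‖a‖ ^ 2 + (h ^ 2)⁻¹ * ‖b‖ ^ 2) * (‖G‖ ^ 2 + h ^ 2 * ‖P‖ ^ 2) -
          (‖a‖ * ‖G‖ + ‖b‖ * ‖P‖) ^ 2 = (h * (‖a‖ * ‖P‖) - h⁻¹ * (‖b‖ * ‖G‖)) ^ 2 := by
        field_simp; ring
      nlinarith [sq_nonneg (h * (‖a‖ * ‖P‖) - h⁻¹ * (‖b‖ * ‖G‖))]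
    rw [norm_toLp_unit_sq, norm_toLp_unit_sq] at cs
    have N0 : 0 ≤ sqNormL2 g + h ^ 2 * sqNormL2 φ := by
      have := sqNormL2_nonneg g
      have := sqNormL2_nonneg φ
      positivity
    have l3 := cs.trans (mul_le_mul_of_nonneg_right hcon N0)
    rw [mul_pow]
    refine (mul_le_mul_of_nonneg_left l3 (by positivity)).trans (le_of_eq ?_)
    field_simp
  · have : (n : ℝ) * ((2 * V + 1) / δ) / h * δ = n * (2 * V + 1) / h := by field_simp
    rw [this]
    gcongr
    linarith

/-! ### Taylor expansion of the loss. -/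

section Taylor

variable {ρ ψ : ℝ → ℝ} {B : ℝ}

theorem abs_sub_le_of_abs_hasDerivAt_le {f f' : ℝ → ℝ} {C v : ℝ} (hf : ∀ x, HasDerivAt f (f' x) x)
    (hC : ∀ x, |x| ≤ |v| → |f' x| ≤ C) : |f v - f 0| ≤ C * |v| := by
  have h1 : ∀ x ∈ uIcc 0 v, ‖f' x‖ ≤ C := fun x hx => hC x <| by
    simpa using abs_sub_left_of_mem_uIcc hx
  simpa using (convex_uIcc 0 v).norm_image_sub_le_of_norm_hasDerivWithin_le
    (fun x _ => (hf x).hasDerivWithinAt) h1 left_mem_uIcc right_mem_uIcc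

theorem abs_deriv_sub_le (h₂ : Differentiable ℝ (deriv ψ)) (hB : ∀ x, |deriv (deriv ψ) x| ≤ B)
    (x v : ℝ) : |deriv ψ (x + v) - deriv ψ x| ≤ B * |v| := by
  have := abs_sub_le_of_abs_hasDerivAt_le (f := fun v => deriv ψ (x + v)) (v := v) (C := B)
    (fun v => (h₂ (x + v)).hasDerivAt.comp_const_add x v) fun y _ => hB _
  simpa using this

theorem abs_sub_linear_le (h₁ : Differentiable ℝ ψ) (h₂ : Differentiable ℝ (deriv ψ))
    (hB : ∀ x, |deriv (deriv ψ) x| ≤ B) (x v : ℝ) :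
    |ψ (x + v) - ψ x - deriv ψ x * v| ≤ B * v ^ 2 := by
  have hB0 : 0 ≤ B := (abs_nonneg _).trans (hB 0)
  have := abs_sub_le_of_abs_hasDerivAt_le (f := fun v => ψ (x + v) - deriv ψ x * v) (v := v)
    (C := B * |v|)
    (fun v => ((h₁ (x + v)).hasDerivAt.comp_const_add x v).sub
      ((hasDerivAt_id v).const_mul (deriv ψ x))) fun y hy => by
        rw [mul_one]
        exact (abs_deriv_sub_le h₂ hB x y).trans (by gcongr)
  simp only [add_zero, mul_zero, sub_zero] at this
  rw [mul_assoc, ← sq, sq_abs] at this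
  rwa [sub_right_comm]

theorem abs_sub_quadratic_le (hψ : ∀ x, HasDerivAt ρ (ψ x) x) (h₁ : Differentiable ℝ ψ)
    (h₂ : Differentiable ℝ (deriv ψ)) (hB : ∀ x, |deriv (deriv ψ) x| ≤ B) (x v : ℝ) :
    |ρ (x + v) - ρ x - ψ x * v - deriv ψ x * v ^ 2 / 2| ≤ B * |v| ^ 3 := by
  have hB0 : 0 ≤ B := (abs_nonneg _).trans (hB 0)
  have := abs_sub_le_of_abs_hasDerivAt_le
    (f := fun v => ρ (x + v) - ψ x * v - deriv ψ x * v ^ 2 / 2)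
    (f' := fun v => ψ (x + v) - ψ x - deriv ψ x * v) (v := v) (C := B * |v| ^ 2)
    (fun v => by
      have h3 := (((hψ (x + v)).comp_const_add x v).sub ((hasDerivAt_id v).const_mul (ψ x))).sub
        ((((hasDerivAt_id v).pow 2).const_mul (deriv ψ x)).div_const 2)
      refine h3.congr_deriv ?_
      simp; ring) fun y hy => by
        refine (abs_sub_linear_le h₁ h₂ hB x y).trans ?_
        rw [← sq_abs]
        gcongr
  simp only [add_zero, mul_zero, sub_zero, ne_eq, OfNat.ofNat_ne_zero, not_false_eq_true, zero_pow,
    zero_div] at this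
  rw [mul_assoc, ← pow_succ] at this
  rwa [show ρ (x + v) - ρ x - ψ x * v - deriv ψ x * v ^ 2 / 2 =
    ρ (x + v) - ψ x * v - deriv ψ x * v ^ 2 / 2 - ρ x by ring]

/-- Expand `ρ` at `τ e` with increment `-τ v`, then `ψ` and `ψ'` at `τ e` around `τ₀ e`. Adding and
subtracting `κ` and `κ'` prepares centred weights on `v²`. -/
theorem loss_sub_ge (hψ : ∀ x, HasDerivAt ρ (ψ x) x) (h₁ : Differentiable ℝ ψ)
    (h₂ : Differentiable ℝ (deriv ψ)) (hB : ∀ x, |deriv (deriv ψ) x| ≤ B) {τ τ₀ e v M : ℝ}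
    (hτ : 0 < τ) (hv : |v| ≤ M) (κ κ' : ℝ) :
    -τ * (ψ (τ₀ * e) * v) - τ * (τ - τ₀) * (deriv ψ (τ₀ * e) * e * v)
      - τ * B * ((τ - τ₀) ^ 2 * M * e ^ 2)
      + τ ^ 2 / 2 * ((deriv ψ (τ₀ * e) - κ) * v ^ 2 + κ * v ^ 2
        - B * |τ - τ₀| * ((|e| - κ') * v ^ 2 + κ' * v ^ 2))
      - B * τ ^ 3 * M * v ^ 2 ≤ ρ (τ * (e - v)) - ρ (τ * e) := by
  have hB0 : 0 ≤ B := (abs_nonneg _).trans (hB 0)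
  have t1 := (abs_le.1 (abs_sub_quadratic_le hψ h₁ h₂ hB (τ * e) (-(τ * v)))).1
  have t2 := abs_sub_linear_le h₁ h₂ hB (τ₀ * e) ((τ - τ₀) * e)
  have t3 := (abs_le.1 (abs_deriv_sub_le h₂ hB (τ₀ * e) ((τ - τ₀) * e))).1
  rw [show τ * e + -(τ * v) = τ * (e - v) by ring, abs_neg, abs_mul, abs_of_pos hτ] at t1
  rw [show τ₀ * e + (τ - τ₀) * e = τ * e by ring] at t2 t3
  rw [abs_mul] at t3
  have t4 : (ψ (τ * e) - ψ (τ₀ * e) - deriv ψ (τ₀ * e) * ((τ - τ₀) * e)) * v ≤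
      B * ((τ - τ₀) * e) ^ 2 * M := by
    refine (le_abs_self _).trans ?_
    rw [abs_mul]
    exact mul_le_mul t2 hv (abs_nonneg _) (by positivity)
  have t5 : B * (τ * |v|) ^ 3 ≤ B * τ ^ 3 * M * v ^ 2 := by
    rw [← sq_abs v]
    have : |v| * |v| ^ 2 ≤ M * |v| ^ 2 := by gcongr
    calc B * (τ * |v|) ^ 3 = B * τ ^ 3 * (|v| * |v| ^ 2) := by ring
      _ ≤ B * τ ^ 3 * (M * |v| ^ 2) := by gcongr
      _ = _ := by ring
  have t6 := mul_le_mul_of_nonneg_left t4 hτ.le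
  have t7 : 0 ≤ τ ^ 2 / 2 * v ^ 2 := by positivity
  have t8 := mul_le_mul_of_nonneg_right t3 t7
  linarith

theorem mean_loss_sub_ge (hψ : ∀ x, HasDerivAt ρ (ψ x) x) (h₁ : Differentiable ℝ ψ)
    (h₂ : Differentiable ℝ (deriv ψ)) (hB : ∀ x, |deriv (deriv ψ) x| ≤ B) {τ τ₀ M : ℝ} {n : ℕ}
    {e v : Fin n → ℝ} (hτ : 0 < τ) (hv : ∀ i, |v i| ≤ M) (κ κ' : ℝ) :
    -τ * (1 / (n : ℝ) * ∑ i, ψ (τ₀ * e i) * v i)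
      - τ * (τ - τ₀) * (1 / (n : ℝ) * ∑ i, deriv ψ (τ₀ * e i) * e i * v i)
      - τ * B * ((τ - τ₀) ^ 2 * M * (1 / (n : ℝ) * ∑ i, e i ^ 2))
      + τ ^ 2 / 2 * (1 / (n : ℝ) * ∑ i, (deriv ψ (τ₀ * e i) - κ) * v i ^ 2
        + κ * (1 / (n : ℝ) * ∑ i, v i ^ 2)
        - B * |τ - τ₀| * (1 / (n : ℝ) * ∑ i, (|e i| - κ') * v i ^ 2
          + κ' * (1 / (n : ℝ) * ∑ i, v i ^ 2)))
      - B * τ ^ 3 * M * (1 / (n : ℝ) * ∑ i, v i ^ 2) ≤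
    1 / (n : ℝ) * ∑ i, ρ (τ * (e i - v i)) - 1 / (n : ℝ) * ∑ i, ρ (τ * e i) := by
  have h := Finset.sum_le_sum (s := Finset.univ) fun i _ =>
    loss_sub_ge (τ₀ := τ₀) (e := e i) hψ h₁ h₂ hB hτ (hv i) κ κ'
  have h' := mul_le_mul_of_nonneg_left h (by positivity : (0 : ℝ) ≤ 1 / n)
  simp only [Finset.sum_add_distrib, Finset.sum_sub_distrib, ← Finset.mul_sum] at h'
  linarith

end Taylor

/-! ### Quadratic empirical functionals. -/

section Quadratic

variable {g φ : ℝ → ℝ} {h : ℝ}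

theorem sqNormL2_mul_le {f g : ℝ → ℝ} {M : ℝ} (hf : MemLp f 2 unitVolume)
    (hg : ∀ x ∈ Icc (0 : ℝ) 1, g x ^ 2 ≤ M) :
    sqNormL2 (fun x => g x * f x) ≤ M * sqNormL2 f := by
  rw [sqNormL2_eq, sqNormL2_eq, ← integral_const_mul]
  refine integral_mono_of_nonneg (ae_of_all _ fun x => sq_nonneg _)
    (hf.integrable_unit_sq.const_mul M) (ae_unitVolume_iff.2 (ae_of_all _ fun x hx => ?_))
  simp only [mul_pow]
  exact mul_le_mul_of_nonneg_right (hg x hx) (sq_nonneg _)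

theorem IsL2Primitive.sq (hg : IsL2Primitive g φ) :
    IsL2Primitive (fun x => g x ^ 2) (fun x => 2 * (g x * φ x)) := by
  have := hg.mul hg
  refine ⟨this.memLp.ae_eq (ae_of_all _ fun x => ?_), fun x hx => ?_⟩
  · ring
  · simp only [pow_two]
    rw [this.eq_integral x hx]
    congr 1
    exact intervalIntegral.integral_congr fun y _ => by ring

theorem IsL2Primitive.sqNormL2_deriv_sq_le (hg : IsL2Primitive g φ) (hh : 0 < h) (hh1 : h ≤ 1) :
    h ^ 2 * sqNormL2 (fun x => 2 * (g x * φ x)) ≤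
      8 / h * (sqNormL2 g + h ^ 2 * sqNormL2 φ) ^ 2 := by
  have h0 := sqNormL2_nonneg g
  have h0' := sqNormL2_nonneg φ
  set y := sqNormL2 g + h ^ 2 * sqNormL2 φ with hy
  have y0 : 0 ≤ y := by positivity
  have h2 := sqNormL2_mul_le hg.memLp fun x hx => hg.sq_le_of_bandwidth hh hh1 hx
  have h3 : sqNormL2 (fun x => 2 * (g x * φ x)) = 4 * sqNormL2 (fun x => g x * φ x) := by
    simp only [sqNormL2]
    rw [← intervalIntegral.integral_const_mul]
    congr 1; ext x; ring
  have h4 : h ^ 2 * sqNormL2 φ ≤ y := by linarith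
  have e : 0 ≤ 8 / h * y := by positivity
  rw [h3]
  calc h ^ 2 * (4 * sqNormL2 (fun x => g x * φ x))
      ≤ h ^ 2 * (4 * (2 / h * y * sqNormL2 φ)) := by gcongr
    _ = 8 / h * y * (h ^ 2 * sqNormL2 φ) := by ring
    _ ≤ 8 / h * y * y := by gcongr
    _ = _ := by ring

/-- Insert `g²` into the linear bound. By the sup bound on `g`, its squared norm of bandwidth `h` is
at most `(2 + 8)/h` times the square of that of `g`. -/
theorem EmpiricalBound.sq_le {c : ℝ} {n : ℕ} {t w : Fin n → ℝ} (H : EmpiricalBound c h t w)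
    (hc : 0 ≤ c) (hh : 0 < h) (hh1 : h ≤ 1) (hg : IsL2Primitive g φ) :
    ((1 / (n : ℝ)) * ∑ i, w i * g (t i) ^ 2) ^ 2 ≤
      10 * c / (n * h ^ 2) * (sqNormL2 g + h ^ 2 * sqNormL2 φ) ^ 2 := by
  have h0 := sqNormL2_nonneg g
  have h0' := sqNormL2_nonneg φ
  refine (H _ _ hg.sq).trans ?_
  have h1 := hg.sqNormL2_deriv_sq_le hh hh1
  have h2 : sqNormL2 (fun x => g x ^ 2) ≤
      2 / h * (sqNormL2 g + h ^ 2 * sqNormL2 φ) ^ 2 := by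
    have := sqNormL2_mul_le hg.memLp_self fun x hx => hg.sq_le_of_bandwidth hh hh1 hx
    simp only [← pow_two] at this
    refine this.trans ?_
    rw [pow_two (_ + _), ← mul_assoc]
    gcongr
    have : 0 ≤ h ^ 2 * sqNormL2 φ := by positivity
    linarith
  refine (mul_le_mul_of_nonneg_left (add_le_add h2 h1) (by positivity)).trans (le_of_eq ?_)
  field_simp; ring

theorem QuasiUniformDesign.exists_abs_sub_le {t : (n : ℕ) → Fin n → ℝ}
    (ht : QuasiUniformDesign t) : ∃ K : ℝ, 0 ≤ K ∧ ∀ n : ℕ, 2 ≤ n → ∀ h : ℝ, 0 < h → h ≤ 1 →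
      ∀ g φ : ℝ → ℝ, IsL2Primitive g φ →
      |(1 / (n : ℝ)) * ∑ i, g (t n i) ^ 2 - sqNormL2 g| ≤
        K / (n * h ^ 2) * (sqNormL2 g + h ^ 2 * sqNormL2 φ) := by
  obtain ⟨K, hK⟩ := ht
  refine ⟨3 * |K|, by positivity, fun n hn h hh hh1 g φ hg => ?_⟩
  have h1 := hK n hn _ hg.sq.memSobolev
  rw [sqNormL2_congr hg.sq.derivUnit_ae] at h1
  refine h1.trans ?_
  have h2 := hg.sqNormL2_deriv_sq_le hh hh1
  have h0 := sqNormL2_nonneg g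
  have h0' := sqNormL2_nonneg φ
  set y := sqNormL2 g + h ^ 2 * sqNormL2 φ with hy
  have y0 : 0 ≤ y := by positivity
  -- A power of `h` is given away: `8 y²/h³ ≤ 9 y²/h⁴`. The deviation `1/(nh²)` still tends to zero.
  have h3 : √(sqNormL2 (fun x => 2 * (g x * φ x))) ≤ 3 / h ^ 2 * y := by
    refine Real.sqrt_le_iff.2 ⟨by positivity, ?_⟩
    have h4 : h ^ 4 * sqNormL2 (fun x => 2 * (g x * φ x)) ≤ 9 * y ^ 2 := by
      calc h ^ 4 * sqNormL2 (fun x => 2 * (g x * φ x))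
          = h ^ 2 * (h ^ 2 * sqNormL2 (fun x => 2 * (g x * φ x))) := by ring
        _ ≤ h ^ 2 * (8 / h * y ^ 2) := by gcongr
        _ = h * (8 * y ^ 2) := by field_simp
        _ ≤ 1 * (8 * y ^ 2) := by gcongr
        _ ≤ 9 * y ^ 2 := by nlinarith [sq_nonneg y]
    rw [mul_pow, div_pow, ← pow_mul, div_mul_eq_mul_div, le_div_iff₀ (by positivity)]
    norm_num
    linarith
  calc K / n * √(sqNormL2 (fun x => 2 * (g x * φ x)))
      ≤ |K| / n * (3 / h ^ 2 * y) := by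
        gcongr
        exact le_abs_self K
    _ = _ := by field_simp

end Quadratic

/-! ### Choice of the radius. -/

set_option maxHeartbeats 800000 in
/-- Positivity of the increment of the objective function on a sphere of radius `D r`. -/
theorem exists_radius_increment_pos {τ₀ κ κ' B Z K C F : ℝ} (hτ₀ : 0 < τ₀) (hκ : 0 < κ)
    (hκ' : 0 ≤ κ') (hB : 0 ≤ B) (hZ : 0 ≤ Z) (hK : 0 ≤ K) (hC : 0 ≤ C) (hF : 0 ≤ F) :
    ∃ D η : ℝ, 0 < D ∧ 0 < η ∧ η ≤ 1 ∧ ∀ r τ β α u M x p S a₁ a₂ a₃ a₄ e I : ℝ,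
      0 < r → |τ - τ₀| ≤ η → |τ - τ₀| ≤ τ₀ / 2 → 0 ≤ β → β ≤ η → 0 ≤ α → α ≤ r → 0 ≤ u →
      u ≤ C * (D * r) → 0 ≤ M → M ≤ 2 * C * D * η → 0 ≤ x → 0 ≤ p → x + p = (D * r) ^ 2 →
      |S - x| ≤ K * β ^ 2 * u ^ 2 → |a₁| ≤ Z * α * u → |a₂| ≤ Z * α * u → |a₃| ≤ Z * β * u ^ 2 →
      |a₄| ≤ Z * β * u ^ 2 → 0 ≤ e → e ≤ Z * α * u → |I| ≤ F * r * (D * r) →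
      0 < -τ * a₁ - τ * (τ - τ₀) * a₂ - τ * B * e
        + τ ^ 2 / 2 * (a₃ + κ * S - B * |τ - τ₀| * (a₄ + κ' * S)) - B * τ ^ 3 * M * S
        + p + 2 * I := by
  -- The gain is at least `c (x + p)`, because `τ ≥ τ₀/2` gives `τ²/2 ≥ τ₀²/8`.
  set c := min (τ₀ ^ 2 * κ / 8) 1 with hc
  have hc0 : 0 < c := lt_min (by positivity) one_pos
  -- `A` collects the losses linear in `D`, totalling `A D r²`; the next choice of `D` makes this at
  -- most half of the gain `c D² r²`.
  set A := 2 * τ₀ * (Z * C) * 2 + 2 * τ₀ * B * (Z * C) + 2 * F with hA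
  have hA0 : 0 ≤ A := by positivity
  set D := 2 * A / c + 1 with hD
  have hD0 : 0 < D := by positivity
  set E := 1 + K * C ^ 2 with hE
  have hE0 : 0 < E := by positivity
  -- `C₃` collects the losses carrying a factor `η`. It depends on `D`, so `η` is fixed last, with
  -- `η C₃ ≤ c/4`.
  set C₃ := 2 * τ₀ ^ 2 * κ * (K * C ^ 2) + 2 * τ₀ ^ 2 * (Z * C ^ 2)
    + 2 * τ₀ ^ 2 * B * (Z * C ^ 2 + κ' * E) + 8 * τ₀ ^ 3 * B * (2 * C * D) * E with hC₃
  have hC₃0 : 0 ≤ C₃ := by positivity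
  refine ⟨D, min 1 (c / (4 * (C₃ + 1))), hD0, lt_min one_pos (by positivity), min_le_left _ _, ?_⟩
  have hη1 : min 1 (c / (4 * (C₃ + 1))) ≤ 1 := min_le_left _ _
  have hη0 : 0 < min 1 (c / (4 * (C₃ + 1))) := lt_min one_pos (by positivity)
  have hηC : min 1 (c / (4 * (C₃ + 1))) * C₃ ≤ c / 4 := by
    have h1 : min 1 (c / (4 * (C₃ + 1))) ≤ c / (4 * (C₃ + 1)) := min_le_right _ _
    rw [le_div_iff₀ (by positivity)] at h1
    nlinarith only [h1, hη0, hC₃0]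
  generalize min 1 (c / (4 * (C₃ + 1))) = η at *
  have hc1 : c ≤ τ₀ ^ 2 * κ / 8 := min_le_left _ _
  have hc2 : c ≤ 1 := min_le_right _ _
  clear_value c A D E C₃
  clear hc
  -- In the application `r² = R`, `α² = 1/(nh)`, `β² = 1/(nh²)`, `u² = ‖g‖² + h²‖g'‖²`, `M` bounds
  -- `|g|`, `x = ‖g‖²`, `p` is the penalty of `g`, and `S` is the empirical mean of `g²`.
  intro r τ β α u M x p S a₁ a₂ a₃ a₄ e I hr hτ hτ' hβ hβη hα hαr hu huC hM hMη hx hp hxp hS h1 h2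
    h3 h4 he heu hI
  have τl : τ₀ / 2 ≤ τ := by linarith only [(abs_le.1 hτ').1, hτ₀]
  have τu : τ ≤ 2 * τ₀ := by linarith only [(abs_le.1 hτ').2, hτ₀]
  have hτ0 : 0 < τ := by linarith only [τl, hτ₀]
  set d := |τ - τ₀| with hd
  have hd0 : 0 ≤ d := abs_nonneg _
  set z := (D * r) ^ 2 with hz
  have hz0 : 0 < z := by positivity
  have huz : u ^ 2 ≤ C ^ 2 * z := by rw [hz, ← mul_pow]; gcongr
  have hβ1 : β ^ 2 ≤ η := by
    calc β ^ 2 = β * β := sq β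
      _ ≤ 1 * η := by gcongr; exact hβη.trans hη1
      _ = η := one_mul η
  have hS' : |S - x| ≤ η * (K * C ^ 2) * z := by
    refine hS.trans ?_
    calc K * β ^ 2 * u ^ 2 ≤ K * η * (C ^ 2 * z) := by gcongr
      _ = _ := by ring
  have hSu : S ≤ E * z := by
    have : η * (K * C ^ 2) * z ≤ 1 * (K * C ^ 2) * z := by gcongr
    rw [hE]; linarith only [this, (abs_le.1 hS').2, hxp, hp]
  have hαu : Z * α * u ≤ Z * C * D * r ^ 2 := by
    calc Z * α * u ≤ Z * r * (C * (D * r)) := by gcongr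
      _ = _ := by ring
  have hβu : Z * β * u ^ 2 ≤ η * (Z * C ^ 2) * z := by
    calc Z * β * u ^ 2 ≤ Z * η * (C ^ 2 * z) := by gcongr
      _ = _ := by ring
  have T1 : τ * a₁ ≤ 2 * τ₀ * (Z * C) * D * r ^ 2 := by
    calc τ * a₁ ≤ τ * (Z * C * D * r ^ 2) := by
          gcongr; exact (le_abs_self _).trans (h1.trans hαu)
      _ ≤ 2 * τ₀ * (Z * C * D * r ^ 2) := by gcongr
      _ = _ := by ring
  have T2 : τ * (τ - τ₀) * a₂ ≤ 2 * τ₀ * (Z * C) * D * r ^ 2 := by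
    calc τ * (τ - τ₀) * a₂ = τ * ((τ - τ₀) * a₂) := by ring
      _ ≤ τ * (d * |a₂|) := by
          refine mul_le_mul_of_nonneg_left ?_ hτ0.le
          rw [hd, ← abs_mul]; exact le_abs_self _
      _ ≤ 2 * τ₀ * (1 * (Z * C * D * r ^ 2)) := by
          gcongr
          · exact hτ.trans hη1
          · exact h2.trans hαu
      _ = _ := by ring
  have T3 : τ * B * e ≤ 2 * τ₀ * B * (Z * C) * D * r ^ 2 := by
    calc τ * B * e ≤ 2 * τ₀ * B * (Z * C * D * r ^ 2) := by
          gcongr; exact heu.trans hαu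
      _ = _ := by ring
  have hτ2 : τ ^ 2 / 2 ≤ 2 * τ₀ ^ 2 := by
    have : τ ^ 2 ≤ (2 * τ₀) ^ 2 := by gcongr
    linarith only [this]
  have hτ2' : τ₀ ^ 2 / 8 ≤ τ ^ 2 / 2 := by
    have : (τ₀ / 2) ^ 2 ≤ τ ^ 2 := by gcongr
    linarith only [this]
  have T4 : -(η * (2 * τ₀ ^ 2 * (Z * C ^ 2)) * z) ≤ τ ^ 2 / 2 * a₃ := by
    have : τ ^ 2 / 2 * (-a₃) ≤ 2 * τ₀ ^ 2 * (η * (Z * C ^ 2) * z) := by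
      calc τ ^ 2 / 2 * (-a₃) ≤ τ ^ 2 / 2 * (η * (Z * C ^ 2) * z) := by
            gcongr; exact (neg_le_abs _).trans (h3.trans hβu)
        _ ≤ _ := by gcongr
    linarith only [this]
  have T5 : τ₀ ^ 2 * κ / 8 * x - η * (2 * τ₀ ^ 2 * κ * (K * C ^ 2)) * z ≤ τ ^ 2 / 2 * (κ * S) := by
    have q1 : τ₀ ^ 2 / 8 * (κ * x) ≤ τ ^ 2 / 2 * (κ * x) := by gcongr
    have q2 : τ ^ 2 / 2 * (κ * (x - S)) ≤ 2 * τ₀ ^ 2 * (κ * (η * (K * C ^ 2) * z)) := by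
      calc τ ^ 2 / 2 * (κ * (x - S)) ≤ τ ^ 2 / 2 * (κ * (η * (K * C ^ 2) * z)) := by
            gcongr; linarith only [(abs_le.1 hS').1]
        _ ≤ _ := by gcongr
    linarith only [q1, q2]
  have T6 : τ ^ 2 / 2 * (B * d * (a₄ + κ' * S)) ≤
      η * (2 * τ₀ ^ 2 * B * (Z * C ^ 2 + κ' * E)) * z := by
    have q1 : a₄ ≤ Z * C ^ 2 * z := by
      refine (le_abs_self _).trans (h4.trans (hβu.trans ?_))
      calc η * (Z * C ^ 2) * z ≤ 1 * (Z * C ^ 2) * z := by gcongr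
        _ = _ := by ring
    calc τ ^ 2 / 2 * (B * d * (a₄ + κ' * S))
        ≤ τ ^ 2 / 2 * (B * d * (Z * C ^ 2 * z + κ' * (E * z))) := by gcongr
      _ ≤ 2 * τ₀ ^ 2 * (B * η * (Z * C ^ 2 * z + κ' * (E * z))) := by gcongr
      _ = _ := by ring
  have T7 : B * τ ^ 3 * M * S ≤ η * (8 * τ₀ ^ 3 * B * (2 * C * D) * E) * z := by
    calc B * τ ^ 3 * M * S ≤ B * τ ^ 3 * M * (E * z) := by gcongr
      _ ≤ B * (2 * τ₀) ^ 3 * (2 * C * D * η) * (E * z) := by gcongr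
      _ = _ := by ring
  have T8 : -(F * D * r ^ 2) ≤ I := by
    linarith only [(abs_le.1 hI).1]
  have T9 : c * z ≤ τ₀ ^ 2 * κ / 8 * x + p := by
    rw [← hxp, mul_add]
    refine add_le_add (by gcongr) ?_
    exact mul_le_of_le_one_left hp hc2
  have T10 : η * C₃ * z ≤ c / 4 * z := by gcongr
  have T11 : A * D * r ^ 2 ≤ c / 2 * z := by
    have q : A ≤ c / 2 * D := by
      rw [hD]; field_simp; linarith
    calc A * D * r ^ 2 ≤ c / 2 * D * D * r ^ 2 := by gcongr
      _ = _ := by rw [hz]; ring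
  have T12 : 0 < c / 4 * z := by positivity
  have e1 : η * C₃ * z = η * (2 * τ₀ ^ 2 * κ * (K * C ^ 2)) * z
    + η * (2 * τ₀ ^ 2 * (Z * C ^ 2)) * z + η * (2 * τ₀ ^ 2 * B * (Z * C ^ 2 + κ' * E)) * z
    + η * (8 * τ₀ ^ 3 * B * (2 * C * D) * E) * z := by rw [hC₃]; ring
  have e2 : A * D * r ^ 2 = 2 * τ₀ * (Z * C) * D * r ^ 2 + 2 * τ₀ * (Z * C) * D * r ^ 2
    + 2 * τ₀ * B * (Z * C) * D * r ^ 2 + 2 * (F * D * r ^ 2) := by rw [hA]; ring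
  have e3 : τ ^ 2 / 2 * (a₃ + κ * S - B * d * (a₄ + κ' * S)) =
    τ ^ 2 / 2 * a₃ + τ ^ 2 / 2 * (κ * S) - τ ^ 2 / 2 * (B * d * (a₄ + κ' * S)) := by ring
  rw [e3]
  linarith only [T1, T2, T3, T4, T5, T6, T7, T8, T9, T10, T11, T12, e1, e2]

/-! ### Deterministic error bound for regular samples. -/

section Deterministic

theorem abs_le_of_sq_le_mul_sq {a k y : ℝ} (hy : 0 ≤ y) (h : a ^ 2 ≤ k * y ^ 2) :
    |a| ≤ √k * y := by
  rcases hy.eq_or_lt with rfl | hy'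
  · have : a = 0 := by simpa using h
    simp [this]
  · have hk : 0 ≤ k := by
      by_contra! hk
      nlinarith [sq_nonneg a, mul_neg_of_neg_of_pos hk (pow_pos hy' 2)]
    refine abs_le_of_sq_le_sq ?_ (by positivity)
    rwa [mul_pow, Real.sq_sqrt hk]

theorem sqNormL2_const_mul (a : ℝ) (f : ℝ → ℝ) :
    sqNormL2 (fun x => a * f x) = a ^ 2 * sqNormL2 f := by
  simp only [sqNormL2, mul_pow]
  exact intervalIntegral.integral_const_mul _ _

theorem sqNormL2_add {f g : ℝ → ℝ} (hf : MemLp f 2 unitVolume) (hg : MemLp g 2 unitVolume) :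
    sqNormL2 (fun x => f x + g x) =
      sqNormL2 f + 2 * ∫ x, f x * g x ∂unitVolume + sqNormL2 g := by
  have i3 : Integrable (fun x => f x * g x) unitVolume := hf.integrable_mul hg
  have i4 := i3.const_mul 2
  have i5 : Integrable (fun x => f x ^ 2 + 2 * (f x * g x)) unitVolume :=
    hf.integrable_unit_sq.add i4
  simp only [sqNormL2_eq]
  rw [← integral_const_mul, ← integral_add hf.integrable_unit_sq i4,
    ← integral_add i5 hg.integrable_unit_sq]
  exact integral_congr_ae (ae_of_all _ fun x => by ring)

/-- The event on which the empirical functionals of the errors `e` are controlled by `b`. -/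
structure IsRegularSample (ψ : ℝ → ℝ) (τ₀ κ κ' b h : ℝ) {n : ℕ} (t e : Fin n → ℝ) : Prop where
  score : EmpiricalBound b h t fun i => ψ (τ₀ * e i)
  scale : EmpiricalBound b h t fun i => deriv ψ (τ₀ * e i) * e i
  hessian : EmpiricalBound b h t fun i => deriv ψ (τ₀ * e i) - κ
  abs : EmpiricalBound b h t fun i => |e i| - κ'
  sq : 1 / (n : ℝ) * ∑ i, e i ^ 2 ≤ b

theorem IsRegularSample.mono {ψ : ℝ → ℝ} {τ₀ κ κ' b c h : ℝ} {n : ℕ} {t e : Fin n → ℝ}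
    (H : IsRegularSample ψ τ₀ κ κ' b h t e) (hh : 0 ≤ h) (hbc : b ≤ c) :
    IsRegularSample ψ τ₀ κ κ' c h t e :=
  ⟨H.score.mono hh hbc, H.scale.mono hh hbc, H.hessian.mono hh hbc, H.abs.mono hh hbc,
    H.sq.trans hbc⟩

variable {m : ℕ} {ρ ψ : ℝ → ℝ} {B τ₀ κ κ' b : ℝ} {f₀ : ℝ → ℝ} {t : (n : ℕ) → Fin n → ℝ}

/-- The objective strictly increases from `f₀` to the sphere: the empirical, design and sup bounds
for `g` feed `exists_radius_increment_pos`. -/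
theorem exists_radius_loss_pos (hm : 1 ≤ m) (hf₀ : MemSobolev m f₀)
    (ht : ∀ n i, t n i ∈ Icc (0 : ℝ) 1) (hψ : ∀ x, HasDerivAt ρ (ψ x) x)
    (hψ₁ : Differentiable ℝ ψ) (hψ₂ : Differentiable ℝ (deriv ψ))
    (hB : ∀ x, |deriv (deriv ψ) x| ≤ B) (ht_unif : QuasiUniformDesign t) (hτ₀ : 0 < τ₀)
    (hκ : 0 < κ) (hκ' : 0 ≤ κ') (hb : 1 ≤ b) :
    ∃ D η : ℝ, 0 < D ∧ 0 < η ∧ ∀ n : ℕ, 2 ≤ n → ∀ h : ℝ, 0 < h → h ≤ 1 →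
      ((n : ℝ) * h ^ 2)⁻¹ ≤ η ^ 2 → (h ^ (2 * m) + ((n : ℝ) * h)⁻¹) / h ≤ η ^ 2 →
      ∀ e : Fin n → ℝ, IsRegularSample ψ τ₀ κ κ' b h (t n) e → ∀ τ : ℝ, |τ - τ₀| ≤ η →
      |τ - τ₀| ≤ τ₀ / 2 → (τ - τ₀) ^ 2 ≤ b * √((n : ℝ)⁻¹) → ∀ g, MemSobolev m g →
      sqNormSobolev m (h ^ (2 * m)) g = D ^ 2 * (h ^ (2 * m) + ((n : ℝ) * h)⁻¹) →
      1 / (n : ℝ) * ∑ i, ρ (τ * e i) < 1 / (n : ℝ) * ∑ i, ρ (τ * (e i - g (t n i))) +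
        h ^ (2 * m) * (2 * ∫ x, derivUnit m f₀ x * derivUnit m g x ∂unitVolume +
          sqNormL2 (derivUnit m g)) := by
  have hB0 : 0 ≤ B := (abs_nonneg _).trans (hB 0)
  obtain ⟨C, hC, hinterp⟩ := exists_sqNormL2_deriv_le hm
  obtain ⟨K, hK, hdesign⟩ := ht_unif.exists_abs_sub_le
  -- Since `b ≥ 1`, the single constant `10 b²` dominates `√b`, `√(10 b)` and the constant of the
  -- scale remainder.
  obtain ⟨D, η, hD, hη, -, H⟩ := exists_radius_increment_pos (B := B) (Z := 10 * b ^ 2) (K := K)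
    (C := √(1 + C)) (F := √(sqNormL2 (derivUnit m f₀))) hτ₀ hκ hκ' hB0 (by positivity) hK
    (Real.sqrt_nonneg _) (Real.sqrt_nonneg _)
  refine ⟨D, η, hD, hη, fun n hn h hh hh1 hβη hMη e he τ hτ hτ' hτ2 g hg hsph => ?_⟩
  have hn0 : (0 : ℝ) < n := by exact_mod_cast (by omega : 0 < n)
  have hgp : IsL2Primitive g (derivUnit 1 g) := by
    have := hg.isL2Primitive hm (j := 0) (by omega)
    rwa [derivUnit_zero] at this
  set φ := derivUnit 1 g
  set lam := h ^ (2 * m) with hlam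
  have hlam0 : 0 < lam := by positivity
  set P := sqNormL2 (derivUnit m g) with hP
  set R := lam + ((n : ℝ) * h)⁻¹ with hR
  have hR0 : 0 < R := by positivity
  set x := sqNormL2 g with hx
  have hx0 : 0 ≤ x := sqNormL2_nonneg _
  have hP0 : 0 ≤ P := sqNormL2_nonneg _
  have hφ0 := sqNormL2_nonneg φ
  set y := x + h ^ 2 * sqNormL2 φ with hy
  have hy0 : 0 ≤ y := by positivity
  have hsph' : x + lam * P = (D * √R) ^ 2 := by
    rw [mul_pow, Real.sq_sqrt hR0.le, ← hsph, sqNormSobolev]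
  have hyz : y ≤ (1 + C) * (D * √R) ^ 2 := by
    rw [← hsph']
    have := hinterp h hh hh1 g hg
    have : 0 ≤ lam * P := by positivity
    rw [hy]; linarith
  have hu2 : √y ^ 2 = y := Real.sq_sqrt hy0
  have huC : √y ≤ √(1 + C) * (D * √R) := by
    refine Real.sqrt_le_iff.2 ⟨by positivity, ?_⟩
    rwa [mul_pow, Real.sq_sqrt (by positivity)]
  have hM2 : 2 / h * y ≤ (2 * √(1 + C) * D * η) ^ 2 := by
    have h1 : 2 / h * y ≤ 2 / h * ((1 + C) * (D * √R) ^ 2) := by gcongr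
    have h2 : 2 / h * ((1 + C) * (D * √R) ^ 2) = 2 * (1 + C) * D ^ 2 * (R / h) := by
      rw [mul_pow, Real.sq_sqrt hR0.le]; ring
    have h3 : 2 * (1 + C) * D ^ 2 * (R / h) ≤ 2 * (1 + C) * D ^ 2 * η ^ 2 := by gcongr
    have h4 : (2 * √(1 + C) * D * η) ^ 2 = 4 * (1 + C) * D ^ 2 * η ^ 2 := by
      rw [mul_pow, mul_pow, mul_pow, Real.sq_sqrt (by positivity)]; ring
    have h5 : 0 ≤ (1 + C) * D ^ 2 * η ^ 2 := by positivity
    linarith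
  have hb10 : √b ≤ 10 * b ^ 2 := by
    refine Real.sqrt_le_iff.2 ⟨by positivity, ?_⟩
    have : b ^ 1 ≤ b ^ 4 := pow_le_pow_right₀ hb (by norm_num)
    have : 0 ≤ b ^ 4 := by positivity
    ring_nf at *; linarith
  have hb10' : √(10 * b) ≤ 10 * b ^ 2 := by
    refine Real.sqrt_le_iff.2 ⟨by positivity, ?_⟩
    have : b ^ 1 ≤ b ^ 4 := pow_le_pow_right₀ hb (by norm_num)
    have : 0 ≤ b ^ 4 := by positivity
    ring_nf at *; linarith
  have hlin : ∀ {w : Fin n → ℝ}, EmpiricalBound b h (t n) w →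
      |1 / (n : ℝ) * ∑ i, w i * g (t n i)| ≤ 10 * b ^ 2 * √(((n : ℝ) * h)⁻¹) * √y := by
    intro w hw
    have h1 := hw g φ hgp
    rw [← hy, ← hu2, div_eq_mul_inv b] at h1
    refine (abs_le_of_sq_le_mul_sq (Real.sqrt_nonneg _) h1).trans ?_
    rw [Real.sqrt_mul (by linarith)]
    gcongr
  have hquad : ∀ {w : Fin n → ℝ}, EmpiricalBound b h (t n) w →
      |1 / (n : ℝ) * ∑ i, w i * g (t n i) ^ 2| ≤
        10 * b ^ 2 * √(((n : ℝ) * h ^ 2)⁻¹) * √y ^ 2 := by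
    intro w hw
    have h1 := hw.sq_le (by linarith) hh hh1 hgp
    rw [← hy, div_eq_mul_inv (10 * b)] at h1
    refine (abs_le_of_sq_le_mul_sq hy0 h1).trans ?_
    rw [Real.sqrt_mul (by linarith), hu2]
    gcongr
  have hv : ∀ i, |g (t n i)| ≤ √(2 / h * y) := fun i =>
    Real.abs_le_sqrt (hgp.sq_le_of_bandwidth hh hh1 (ht n i))
  have hτ0 : 0 < τ := by linarith [(abs_le.1 hτ').1]
  have key := H (√R) τ (√(((n : ℝ) * h ^ 2)⁻¹)) (√(((n : ℝ) * h)⁻¹)) (√y) (√(2 / h * y)) x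
    (lam * P) (1 / (n : ℝ) * ∑ i, g (t n i) ^ 2) _ _ _ _
    ((τ - τ₀) ^ 2 * √(2 / h * y) * (1 / (n : ℝ) * ∑ i, e i ^ 2))
    (lam * ∫ x, derivUnit m f₀ x * derivUnit m g x ∂unitVolume)
    (Real.sqrt_pos.2 hR0) hτ hτ' (Real.sqrt_nonneg _) (Real.sqrt_le_iff.2 ⟨hη.le, hβη⟩)
    (Real.sqrt_nonneg _) (Real.sqrt_le_sqrt (by rw [hR]; linarith)) (Real.sqrt_nonneg _) huC
    (Real.sqrt_nonneg _) (Real.sqrt_le_iff.2 ⟨by positivity, hM2⟩) hx0 (by positivity) hsph'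
    (by
      rw [hu2, Real.sq_sqrt (by positivity), ← div_eq_mul_inv]
      exact hdesign n hn h hh hh1 g φ hgp)
    (hlin he.score) (hlin he.scale) (hquad he.hessian) (hquad he.abs)
    (by positivity)
    (by
      -- The rate `n^{-1/2}` of `(τ - τ₀)²` and the factor `h^{-1/2}` of the sup bound combine to
      -- `(nh)^{-1/2}`, the size of the linear terms.
      calc (τ - τ₀) ^ 2 * √(2 / h * y) * (1 / (n : ℝ) * ∑ i, e i ^ 2)
          ≤ b * √((n : ℝ)⁻¹) * √(2 / h * y) * b := by
            gcongr
            exact he.sq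
        _ = b ^ 2 * (√2 * √(((n : ℝ) * h)⁻¹) * √y) := by
            rw [Real.sqrt_mul (by positivity), div_eq_mul_inv, Real.sqrt_mul (by positivity),
              mul_inv, Real.sqrt_mul (by positivity)]
            ring
        _ ≤ b ^ 2 * (10 * √(((n : ℝ) * h)⁻¹) * √y) := by
            gcongr
            exact Real.sqrt_le_iff.2 ⟨by norm_num, by norm_num⟩
        _ = _ := by ring)
    (by
      rw [abs_mul, abs_of_pos hlam0]
      have h1 := abs_integral_mul_le hf₀.memLp hg.memLp
      have h2 : √lam * √P ≤ D * √R := by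
        rw [← Real.sqrt_mul hlam0.le]
        refine Real.sqrt_le_iff.2 ⟨by positivity, ?_⟩
        linarith
      calc lam * |∫ x, derivUnit m f₀ x * derivUnit m g x ∂unitVolume|
          ≤ lam * (√(sqNormL2 (derivUnit m f₀)) * √P) := by gcongr
        _ = √(sqNormL2 (derivUnit m f₀)) * √lam * (√lam * √P) := by
            nth_rewrite 1 [← Real.mul_self_sqrt hlam0.le]; ring
        _ ≤ √(sqNormL2 (derivUnit m f₀)) * √R * (D * √R) := by
            gcongr
            rw [hR]
            have : 0 ≤ ((n : ℝ) * h)⁻¹ := by positivity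
            linarith)
  have key2 := mean_loss_sub_ge (τ₀ := τ₀) (e := e) hψ hψ₁ hψ₂ hB hτ0 hv κ κ'
  linarith

/-- If `g = f - f₀` lay outside the ball, `θ g` with `θ ≤ 1` would lie on the sphere. Convexity,
with `θ² ≤ θ` in the penalty, makes the increment at `θ g` at most `θ` times that at `g`, which is
nonpositive: a contradiction. -/
theorem exists_isMTypeSpline_bound (hm : 1 ≤ m) (hf₀ : MemSobolev m f₀)
    (ht : ∀ n i, t n i ∈ Icc (0 : ℝ) 1) (hρ : ConvexOn ℝ univ ρ) (hψ : ∀ x, HasDerivAt ρ (ψ x) x)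
    (hψ₁ : Differentiable ℝ ψ) (hψ₂ : Differentiable ℝ (deriv ψ))
    (hB : ∀ x, |deriv (deriv ψ) x| ≤ B) (ht_unif : QuasiUniformDesign t) (hτ₀ : 0 < τ₀)
    (hκ : 0 < κ) (hκ' : 0 ≤ κ') (hb : 1 ≤ b) :
    ∃ D η : ℝ, 0 < D ∧ 0 < η ∧ ∀ n : ℕ, 2 ≤ n → ∀ h : ℝ, 0 < h → h ≤ 1 →
      ((n : ℝ) * h ^ 2)⁻¹ ≤ η ^ 2 → (h ^ (2 * m) + ((n : ℝ) * h)⁻¹) / h ≤ η ^ 2 →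
      ∀ e : Fin n → ℝ, IsRegularSample ψ τ₀ κ κ' b h (t n) e → ∀ s : ℝ, |s⁻¹ - τ₀| ≤ η →
      |s⁻¹ - τ₀| ≤ τ₀ / 2 → (s⁻¹ - τ₀) ^ 2 ≤ b * √((n : ℝ)⁻¹) → ∀ f,
      IsMTypeSpline m ρ (h ^ (2 * m)) s (t n) (fun i => f₀ (t n i) + e i) f →
      sqNormSobolev m (h ^ (2 * m)) (fun x => f x - f₀ x) ≤
        D ^ 2 * (h ^ (2 * m) + ((n : ℝ) * h)⁻¹) := by
  obtain ⟨D, η, hD, hη, H⟩ := exists_radius_loss_pos hm hf₀ ht hψ hψ₁ hψ₂ hB ht_unif hτ₀ hκ hκ' hb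
  refine ⟨D, η, hD, hη, fun n hn h hh hh1 hβη hMη e he s hs hs' hs2 f hf => ?_⟩
  have hn0 : (0 : ℝ) < n := by exact_mod_cast (by omega : 0 < n)
  by_contra! hcon
  set lam := h ^ (2 * m) with hlam
  have hlam0 : 0 < lam := by positivity
  have hg : MemSobolev m (fun x => f x - f₀ x) := by
    simpa [sub_eq_add_neg] using hf.1.add_const_mul hm hf₀ (-1)
  set g : ℝ → ℝ := fun x => f x - f₀ x with hgdef
  set R := lam + ((n : ℝ) * h)⁻¹ with hR
  have hR0 : 0 < R := by positivity
  set z := sqNormSobolev m lam g with hz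
  have hz0 : 0 < z := lt_trans (by positivity) hcon
  set θ := √(D ^ 2 * R / z) with hθ
  have hθ2 : θ ^ 2 = D ^ 2 * R / z := Real.sq_sqrt (by positivity)
  have hθ0 : 0 ≤ θ := Real.sqrt_nonneg _
  have hθ1 : θ ≤ 1 := Real.sqrt_le_one.2 ((div_le_one hz0).2 hcon.le)
  have hθg : MemSobolev m (fun x => θ * g x) := by
    have := hg.add_const_mul hm hg (θ - 1)
    convert this using 2
    ring
  have hdθ : derivUnit m (fun x => θ * g x) =ᵐ[unitVolume] fun x => θ * derivUnit m g x := by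
    have := hg.derivUnit_add_const_mul hm hg (θ - 1)
    convert this using 2
    · ext x; ring
    · ring
  have hsq : sqNormL2 (derivUnit m fun x => θ * g x) = θ ^ 2 * sqNormL2 (derivUnit m g) := by
    rw [sqNormL2_congr hdθ, sqNormL2_const_mul]
  have hsph : sqNormSobolev m lam (fun x => θ * g x) = D ^ 2 * R := by
    have : sqNormSobolev m lam (fun x => θ * g x) = θ ^ 2 * z := by
      rw [sqNormSobolev, hsq, sqNormL2_const_mul, hz, sqNormSobolev]; ring
    rw [this, hθ2]
    field_simp
  have key := H n hn h hh hh1 hβη hMη e he s⁻¹ hs hs' hs2 _ hθg hsph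
  set I := ∫ x, derivUnit m f₀ x * derivUnit m g x ∂unitVolume with hI
  have hIθ : ∫ x, derivUnit m f₀ x * derivUnit m (fun x => θ * g x) x ∂unitVolume = θ * I := by
    rw [hI, ← integral_const_mul]
    refine integral_congr_ae (hdθ.mono fun x hx => ?_)
    simp only [hx]; ring
  rw [hsq, hIθ] at key
  have hdf : derivUnit m f =ᵐ[unitVolume] fun x => derivUnit m f₀ x + derivUnit m g x := by
    have := hf₀.derivUnit_add_const_mul hm hg 1
    simpa [hgdef] using this
  have hmin := hf.2 f₀ hf₀
  simp only [splineObjective] at hmin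
  rw [sqNormL2_congr hdf, sqNormL2_add hf₀.memLp hg.memLp, ← hI] at hmin
  have e1 : ∀ i, (f₀ (t n i) + e i - f (t n i)) / s = s⁻¹ * (e i - g (t n i)) := fun i => by
    rw [div_eq_inv_mul]; simp only [hgdef]; ring
  have e2 : ∀ i, (f₀ (t n i) + e i - f₀ (t n i)) / s = s⁻¹ * e i := fun i => by
    rw [div_eq_inv_mul]; ring
  simp only [e1, e2] at hmin
  have conv : 1 / (n : ℝ) * ∑ i, ρ (s⁻¹ * (e i - θ * g (t n i))) ≤
      (1 - θ) * (1 / (n : ℝ) * ∑ i, ρ (s⁻¹ * e i)) +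
        θ * (1 / (n : ℝ) * ∑ i, ρ (s⁻¹ * (e i - g (t n i)))) := by
    have h1 : ∑ i, ρ (s⁻¹ * (e i - θ * g (t n i))) ≤
        ∑ i, ((1 - θ) * ρ (s⁻¹ * e i) + θ * ρ (s⁻¹ * (e i - g (t n i)))) := by
      refine Finset.sum_le_sum fun i _ => ?_
      have := hρ.2 (mem_univ (s⁻¹ * e i)) (mem_univ (s⁻¹ * (e i - g (t n i))))
        (sub_nonneg.2 hθ1) hθ0 (by ring)
      simp only [smul_eq_mul] at this
      refine le_trans (le_of_eq ?_) this
      congr 1; ring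
    rw [Finset.sum_add_distrib, ← Finset.mul_sum, ← Finset.mul_sum] at h1
    have := mul_le_mul_of_nonneg_left h1 (by positivity : (0 : ℝ) ≤ 1 / n)
    linarith
  have hP0 := sqNormL2_nonneg (derivUnit m g)
  have hquad : lam * (θ ^ 2 * sqNormL2 (derivUnit m g)) ≤ θ * (lam * sqNormL2 (derivUnit m g)) := by
    have : θ ^ 2 ≤ θ := by nlinarith
    calc lam * (θ ^ 2 * sqNormL2 (derivUnit m g)) ≤ lam * (θ * sqNormL2 (derivUnit m g)) := by gcongr
      _ = _ := by ring
  have hminθ := mul_le_mul_of_nonneg_left hmin hθ0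
  linarith

end Deterministic

/-! ### Asymptotics of the bandwidth, and probabilities of the good events. -/

/-- Once `h ≤ 1`, `λ = h^{2m} ≤ h²`, so `n h² ≥ n λ`, which is of order `n^{1-γ}`. -/
theorem tendsto_bandwidth {m : ℕ} (hm : 1 ≤ m) {lam : ℕ → ℝ} (hlam_pos : ∀ n, 0 < lam n) {γ : ℝ}
    (hγ : γ ∈ Ioo (0 : ℝ) 1) (hlam : lam =Θ[atTop] fun n : ℕ => (n : ℝ) ^ (-γ)) :
    Tendsto (fun n => lam n ^ (1 / (2 * (m : ℝ)))) atTop (𝓝 0) ∧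
      Tendsto (fun n : ℕ => ((n : ℝ) * (lam n ^ (1 / (2 * (m : ℝ)))) ^ 2)⁻¹) atTop (𝓝 0) := by
  have hm0 : (0 : ℝ) < m := by exact_mod_cast hm
  have h0 : Tendsto (fun n : ℕ => (n : ℝ) ^ (-γ)) atTop (𝓝 0) :=
    (tendsto_rpow_neg_atTop hγ.1).comp tendsto_natCast_atTop_atTop
  have h1 : Tendsto lam atTop (𝓝 0) := hlam.1.trans_tendsto h0
  have h2 : Tendsto (fun n => lam n ^ (1 / (2 * (m : ℝ)))) atTop (𝓝 0) := by
    have := h1.rpow_const (p := 1 / (2 * (m : ℝ))) (Or.inr (by positivity))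
    rwa [Real.zero_rpow (by positivity)] at this
  refine ⟨h2, ?_⟩
  obtain ⟨c, hc, hle⟩ := hlam.2.exists_pos
  have h3 : Tendsto (fun n : ℕ => c * (n : ℝ) ^ (-(1 - γ))) atTop (𝓝 0) := by
    have := ((tendsto_rpow_neg_atTop (sub_pos.2 hγ.2)).comp
      tendsto_natCast_atTop_atTop).const_mul c
    simpa using this
  refine squeeze_zero' (Eventually.of_forall fun n => by positivity) ?_ h3
  filter_upwards [hle.bound, h2.eventually (eventually_le_nhds one_pos), eventually_ge_atTop 1]
    with n h4 h5 hn
  have hn0 : (0 : ℝ) < n := by exact_mod_cast hn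
  set h := lam n ^ (1 / (2 * (m : ℝ))) with hh
  have hh0 : 0 < h := Real.rpow_pos_of_pos (hlam_pos n) _
  have hpow : h ^ (2 * m) = lam n := by
    rw [hh, ← Real.rpow_natCast, ← Real.rpow_mul (hlam_pos n).le]
    push_cast
    rw [one_div_mul_cancel (by positivity), Real.rpow_one]
  have h6 : lam n ≤ h ^ 2 := by
    rw [← hpow]; exact pow_le_pow_of_le_one hh0.le h5 (by omega)
  rw [Real.norm_of_nonneg (by positivity), Real.norm_of_nonneg (hlam_pos n).le] at h4
  have h7 : (n : ℝ) ^ (-γ) ≤ c * h ^ 2 := h4.trans (by gcongr)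
  have h8 : (n : ℝ) ^ (-(1 - γ)) = (n : ℝ) ^ γ / n := by
    rw [neg_sub, Real.rpow_sub_one hn0.ne']
  rw [h8, inv_le_iff_one_le_mul₀ (by positivity)]
  have h9 : (n : ℝ) ^ γ * (n : ℝ) ^ (-γ) = 1 := by
    rw [← Real.rpow_add hn0]; simp
  calc (1 : ℝ) = (n : ℝ) ^ γ * (n : ℝ) ^ (-γ) := h9.symm
    _ ≤ (n : ℝ) ^ γ * (c * h ^ 2) := by gcongr
    _ = _ := by field_simp

section RegularSample

variable {Ω : Type*} [MeasurableSpace Ω] {μ : Measure Ω} [IsProbabilityMeasure μ]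

theorem memLp_deriv_comp {ψ : ℝ → ℝ} (hψ₂ : Differentiable ℝ (deriv ψ)) {B : ℝ}
    (hB : ∀ x, |deriv (deriv ψ) x| ≤ B) {X : Ω → ℝ} (hX : MemLp X 2 μ) :
    MemLp (fun ω => deriv ψ (X ω)) 2 μ := by
  have hX' : MemLp (fun ω => |X ω|) 2 μ := hX.abs
  have hd : MemLp (fun ω => |deriv ψ 0| + B * |X ω|) 2 μ :=
    (memLp_const |deriv ψ 0|).add (hX'.const_mul B)
  refine hd.mono (hψ₂.continuous.comp_aestronglyMeasurable hX.1) (ae_of_all _ fun ω => ?_)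
  have h1 := abs_deriv_sub_le hψ₂ hB 0 (X ω)
  rw [zero_add] at h1
  have h2 := abs_sub_abs_le_abs_sub (deriv ψ (X ω)) (deriv ψ 0)
  refine le_trans ?_ (le_abs_self _)
  rw [Real.norm_eq_abs]
  linarith only [h1, h2]

/-- The four weights are centred square integrable functions of the errors, and Markov's inequality
handles the mean square. The level `b` is uniform in `n`, `h` and the design. -/
theorem exists_measure_not_isRegularSample_le {ε : ℕ → Ω → ℝ} (hε_meas : ∀ i, Measurable (ε i))
    (hε_indep : iIndepFun ε μ) (hε_ident : ∀ i, IdentDistrib (ε i) (ε 0) μ μ) {ψ : ℝ → ℝ}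
    (hψ₁ : Differentiable ℝ ψ) (hψ₂ : Differentiable ℝ (deriv ψ)) {B : ℝ}
    (hB : ∀ x, |deriv (deriv ψ) x| ≤ B) {τ₀ : ℝ} (hψ_sq : MemLp (fun ω => ψ (τ₀ * ε 0 ω)) 2 μ)
    (hψ_mean : ∫ ω, ψ (τ₀ * ε 0 ω) ∂μ = 0)
    (hψ'ε_sq : MemLp (fun ω => deriv ψ (τ₀ * ε 0 ω) * ε 0 ω) 2 μ)
    (hψ'ε_mean : ∫ ω, deriv ψ (τ₀ * ε 0 ω) * ε 0 ω ∂μ = 0) (hε_sq : MemLp (ε 0) 2 μ)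
    {δ : ℝ} (hδ : 0 < δ) :
    ∃ b : ℝ, 1 ≤ b ∧ ∀ n : ℕ, 1 ≤ n → ∀ h : ℝ, 0 < h → h ≤ 1 → ∀ t : Fin n → ℝ,
      (∀ i, t i ∈ Icc (0 : ℝ) 1) →
      μ {ω | ¬ IsRegularSample ψ τ₀ (∫ ω, deriv ψ (τ₀ * ε 0 ω) ∂μ) (∫ ω, |ε 0 ω| ∂μ) b h t
        (fun i => ε i ω)} ≤ 5 * ENNReal.ofReal δ := by
  have m1 : Measurable ψ := hψ₁.continuous.measurable
  have m2 : Measurable (deriv ψ) := hψ₂.continuous.measurable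
  have hL := memLp_deriv_comp hψ₂ hB (hε_sq.const_mul τ₀)
  set κ := ∫ ω, deriv ψ (τ₀ * ε 0 ω) ∂μ with hκ
  set κ' := ∫ ω, |ε 0 ω| ∂μ with hκ'
  have mτ : Measurable fun x : ℝ => τ₀ * x := measurable_id.const_mul τ₀
  have w1 := isWhiteNoise_comp hε_meas hε_indep hε_ident (f := fun x => ψ (τ₀ * x))
    (m1.comp mτ) hψ_sq hψ_mean
  have w2 := isWhiteNoise_comp hε_meas hε_indep hε_ident (f := fun x => deriv ψ (τ₀ * x) * x)
    ((m2.comp mτ).mul measurable_id) hψ'ε_sq hψ'ε_mean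
  have w3 := isWhiteNoise_comp hε_meas hε_indep hε_ident (f := fun x => deriv ψ (τ₀ * x) - κ)
    ((m2.comp mτ).sub_const κ) (hL.sub (memLp_const κ)) (by
      rw [integral_sub (hL.integrable (by norm_num)) (integrable_const _)]
      simp [hκ])
  have w4 := isWhiteNoise_comp hε_meas hε_indep hε_ident (f := fun x => |x| - κ')
    (measurable_id.abs.sub_const κ') (hε_sq.abs.sub (memLp_const κ')) (by
      have hi : Integrable (fun ω => |ε 0 ω|) μ := hε_sq.abs.integrable (by norm_num)
      rw [integral_sub hi (integrable_const _)]
      simp [hκ'])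
  generalize (∫ ω, ψ (τ₀ * ε 0 ω) ^ 2 ∂μ) = V1 at w1
  generalize (∫ ω, (deriv ψ (τ₀ * ε 0 ω) * ε 0 ω) ^ 2 ∂μ) = V2 at w2
  generalize (∫ ω, (deriv ψ (τ₀ * ε 0 ω) - κ) ^ 2 ∂μ) = V3 at w3
  generalize (∫ ω, (|ε 0 ω| - κ') ^ 2 ∂μ) = V4 at w4
  set V5 := ∫ ω, ε 0 ω ^ 2 ∂μ with hV5
  have v1 := w1.nonneg
  have v2 := w2.nonneg
  have v3 := w3.nonneg
  have v4 := w4.nonneg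
  have v5 : 0 ≤ V5 := integral_nonneg fun _ => sq_nonneg _
  set b := 1 + (2 * (V1 + V2 + V3 + V4 + V5) + 1) / δ with hb
  have hVb : ∀ V, V ≤ V1 + V2 + V3 + V4 + V5 → (2 * V + 1) / δ ≤ b := fun V hV => by
    have : (2 * V + 1) / δ ≤ (2 * (V1 + V2 + V3 + V4 + V5) + 1) / δ := by gcongr
    rw [hb]; linarith
  have hb1 : 1 ≤ b := le_add_of_nonneg_right (by positivity)
  refine ⟨b, hb1, fun n hn h hh hh1 t ht => ?_⟩
  have hn0 : (0 : ℝ) < n := by exact_mod_cast hn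
  have p1 := measure_not_empiricalBound_le w1 hδ hn hh hh1 ht
  have p2 := measure_not_empiricalBound_le w2 hδ hn hh hh1 ht
  have p3 := measure_not_empiricalBound_le w3 hδ hn hh hh1 ht
  have p4 := measure_not_empiricalBound_le w4 hδ hn hh hh1 ht
  have hLi : ∀ i, MemLp (ε i) 2 μ := fun i => (hε_ident i).memLp_iff.2 hε_sq
  have p5 : μ {ω | b < 1 / (n : ℝ) * ∑ i : Fin n, ε i ω ^ 2} ≤ ENNReal.ofReal δ := by
    have hi : Integrable (fun ω => 1 / (n : ℝ) * ∑ i : Fin n, ε i ω ^ 2) μ :=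
      (integrable_finsetSum Finset.univ fun (i : Fin n) _ => (hLi i).integrable_sq).const_mul _
    refine measure_lt_le_of_integral_le hi (fun ω => by positivity) (a := V5) (le_of_eq ?_)
      (by linarith) ?_
    · rw [integral_const_mul,
        integral_finsetSum Finset.univ fun (i : Fin n) _ => (hLi i).integrable_sq]
      have : ∀ i : Fin n, ∫ ω, ε i ω ^ 2 ∂μ = V5 := fun i =>
        ((hε_ident i).comp (measurable_id.pow_const 2)).integral_eq
      simp only [this, Finset.sum_const, Finset.card_univ, Fintype.card_fin, nsmul_eq_mul]
      field_simp
    · have h1 := hVb V5 (by linarith)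
      rw [div_le_iff₀ hδ] at h1
      linarith
  have hsub : {ω | ¬ IsRegularSample ψ τ₀ κ κ' b h t (fun i => ε i ω)} ⊆
      {ω | ¬ EmpiricalBound ((2 * V1 + 1) / δ) h t fun i => ψ (τ₀ * ε i ω)} ∪
      {ω | ¬ EmpiricalBound ((2 * V2 + 1) / δ) h t fun i => deriv ψ (τ₀ * ε i ω) * ε i ω} ∪
      {ω | ¬ EmpiricalBound ((2 * V3 + 1) / δ) h t fun i => deriv ψ (τ₀ * ε i ω) - κ} ∪
      {ω | ¬ EmpiricalBound ((2 * V4 + 1) / δ) h t fun i => |ε i ω| - κ'} ∪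
      {ω | b < 1 / (n : ℝ) * ∑ i : Fin n, ε i ω ^ 2} := by
    intro ω hω
    by_contra hcon
    simp only [mem_union, mem_ofPred_eq, not_or, not_not, not_lt] at hcon
    obtain ⟨⟨⟨⟨q1, q2⟩, q3⟩, q4⟩, q5⟩ := hcon
    exact hω ⟨q1.mono hh.le (hVb _ (by linarith)), q2.mono hh.le (hVb _ (by linarith)),
      q3.mono hh.le (hVb _ (by linarith)), q4.mono hh.le (hVb _ (by linarith)), q5⟩
  refine (measure_mono hsub).trans ?_
  refine (measure_union_le _ _).trans ((add_le_add ((measure_union_le _ _).trans (add_le_add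
    ((measure_union_le _ _).trans (add_le_add ((measure_union_le _ _).trans (add_le_add p1 p2)) p3))
    p4)) p5).trans (le_of_eq ?_))
  ring

end RegularSample

/-- Only the rate `n^{-1/4}` is used, which `m/(2m+1) ≥ 1/4` supplies. `T` is chosen before `η`
because the theorem obtains its `η` from a constant involving `T`. -/
theorem IsBigOInProbability.exists_abs_inv_sub_inv_le {Ω : Type*} [MeasurableSpace Ω]
    {μ : Measure Ω} {m : ℕ} (hm : 1 ≤ m) {σ : ℝ} (hσ : 0 < σ) {σhat : ℕ → Ω → ℝ}
    (hσhat : IsBigOInProbability μ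
      (fun n ω => (n : ℝ) ^ ((m : ℝ) / (2 * (m : ℝ) + 1)) * (σhat n ω - σ)) (fun _ => 1))
    {δ : ℝ} (hδ : 0 < δ) :
    ∃ T : ℝ, 0 ≤ T ∧ ∀ η : ℝ, 0 < η → ∀ᶠ n : ℕ in atTop,
      μ {ω | ¬ (0 < σhat n ω ∧ |(σhat n ω)⁻¹ - σ⁻¹| ≤ η ∧
        ((σhat n ω)⁻¹ - σ⁻¹) ^ 2 ≤ T * √((n : ℝ)⁻¹))} ≤ ENNReal.ofReal δ := by
  obtain ⟨M, hM⟩ := hσhat δ hδ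
  refine ⟨(2 * |M| / σ ^ 2) ^ 2, by positivity, fun η hη => ?_⟩
  have hlim : Tendsto (fun n : ℕ => |M| * (n : ℝ) ^ (-(1 / 4 : ℝ))) atTop (𝓝 0) := by
    have := ((tendsto_rpow_neg_atTop (y := 1 / 4) (by norm_num)).comp
      tendsto_natCast_atTop_atTop).const_mul |M|
    simpa using this
  have h1 : ∀ᶠ n : ℕ in atTop, |M| * (n : ℝ) ^ (-(1 / 4 : ℝ)) ≤ min (σ / 2) (η * σ ^ 2 / 2) :=
    hlim.eventually (eventually_le_nhds (lt_min (by positivity) (by positivity)))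
  filter_upwards [hM, h1, eventually_ge_atTop 1] with n hn hn1 hn2
  refine (measure_mono ?_).trans hn
  intro ω hω
  by_contra hcon
  refine hω ?_
  have hn0 : (0 : ℝ) < n := by exact_mod_cast hn2
  have hn1' : (1 : ℝ) ≤ n := by exact_mod_cast hn2
  simp only [mem_ofPred_eq, abs_one, mul_one, not_lt] at hcon
  set p := (m : ℝ) / (2 * (m : ℝ) + 1)
  have hp : 1 / 4 ≤ p := by
    have : (1 : ℝ) ≤ m := by exact_mod_cast hm
    rw [le_div_iff₀ (by positivity)]; linarith
  have hpow : (0 : ℝ) < (n : ℝ) ^ (1 / 4 : ℝ) := by positivity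
  have h2 : |σhat n ω - σ| ≤ |M| * (n : ℝ) ^ (-(1 / 4 : ℝ)) := by
    rw [Real.rpow_neg hn0.le, ← div_eq_mul_inv, le_div_iff₀ hpow, mul_comm]
    rw [abs_mul, abs_of_pos (by positivity : (0 : ℝ) < (n : ℝ) ^ p)] at hcon
    calc (n : ℝ) ^ (1 / 4 : ℝ) * |σhat n ω - σ| ≤ (n : ℝ) ^ p * |σhat n ω - σ| := by gcongr
      _ ≤ M := hcon
      _ ≤ |M| := le_abs_self M
  have h3 := h2.trans (hn1.trans (min_le_left _ _))
  have h4 : σ / 2 ≤ σhat n ω := by linarith [(abs_le.1 h3).1]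
  have hs0 : 0 < σhat n ω := by linarith
  have h5 : |(σhat n ω)⁻¹ - σ⁻¹| ≤ 2 / σ ^ 2 * (|M| * (n : ℝ) ^ (-(1 / 4 : ℝ))) := by
    have e : (σhat n ω)⁻¹ - σ⁻¹ = -((σhat n ω - σ) / (σhat n ω * σ)) := by field_simp; ring
    rw [e, abs_neg, abs_div, abs_of_pos (by positivity : 0 < σhat n ω * σ)]
    calc |σhat n ω - σ| / (σhat n ω * σ) ≤ (|M| * (n : ℝ) ^ (-(1 / 4 : ℝ))) / (σ / 2 * σ) := by gcongr
      _ = _ := by field_simp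
  refine ⟨hs0, ?_, ?_⟩
  · refine h5.trans ?_
    calc 2 / σ ^ 2 * (|M| * (n : ℝ) ^ (-(1 / 4 : ℝ))) ≤ 2 / σ ^ 2 * (η * σ ^ 2 / 2) := by
          gcongr; exact hn1.trans (min_le_right _ _)
      _ = η := by field_simp
  · have h6 := pow_le_pow_left₀ (abs_nonneg _) h5 2
    rw [sq_abs] at h6
    refine h6.trans (le_of_eq ?_)
    have : ((n : ℝ) ^ (-(1 / 4 : ℝ))) ^ 2 = √((n : ℝ)⁻¹) := by
      rw [Real.sqrt_eq_rpow, ← Real.rpow_natCast, ← Real.rpow_mul hn0.le, Real.inv_rpow hn0.le,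
        ← Real.rpow_neg hn0.le]
      norm_num
    rw [mul_pow, mul_pow, this]
    ring

end

/-! ### The convergence rate. -/

theorem theorem4 {Ω : Type*} [MeasurableSpace Ω] (μ : Measure Ω) [IsProbabilityMeasure μ]
    (m : ℕ) (hm : 1 ≤ m)
    -- regression function, design points, errors
    (f₀ : ℝ → ℝ) (hf₀ : MemSobolev m f₀)
    (t : (n : ℕ) → Fin n → ℝ) (ht : ∀ n i, t n i ∈ Icc (0 : ℝ) 1)
    (ε : ℕ → Ω → ℝ) (hε_meas : ∀ i, Measurable (ε i)) (hε_indep : iIndepFun ε μ)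
    (hε_ident : ∀ i, IdentDistrib (ε i) (ε 0) μ μ)
    -- the loss function is convex and its derivative has a bounded second derivative
    (ρ ψ : ℝ → ℝ) (hρ : ConvexOn ℝ univ ρ) (hψ : ∀ x, HasDerivAt ρ (ψ x) x)
    (hψ₁ : Differentiable ℝ ψ) (hψ₂ : Differentiable ℝ (deriv ψ))
    (hψ₂_bdd : ∃ B : ℝ, ∀ x, |deriv (deriv ψ) x| ≤ B)
    -- moment conditions
    (σ : ℝ) (hσ : 0 < σ)
    (hψ_sq : MemLp (fun ω => ψ (ε 0 ω / σ)) 2 μ)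
    (hψ_mean : ∫ ω, ψ (ε 0 ω / σ) ∂μ = 0)
    (hψ'_pos : 0 < ∫ ω, deriv ψ (ε 0 ω / σ) ∂μ)
    (hψ'ε_sq : MemLp (fun ω => deriv ψ (ε 0 ω / σ) * ε 0 ω) 2 μ)
    (hψ'ε_mean : ∫ ω, deriv ψ (ε 0 ω / σ) * ε 0 ω ∂μ = 0)
    (hε_sq : MemLp (ε 0) 2 μ)
    -- quasi-uniform design
    (ht_unif : QuasiUniformDesign t)
    -- scale estimate
    (σhat : ℕ → Ω → ℝ) (hσhat_meas : ∀ n, Measurable (σhat n))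
    (hσhat : IsBigOInProbability μ
      (fun n ω => (n : ℝ) ^ ((m : ℝ) / (2 * (m : ℝ) + 1)) * (σhat n ω - σ)) (fun _ => 1))
    -- smoothing parameter
    (lam : ℕ → ℝ) (hlam_pos : ∀ n, 0 < lam n)
    (γ : ℝ) (hγ : γ ∈ Ioo (0 : ℝ) 1)
    (hlam : lam =Θ[atTop] fun n : ℕ => (n : ℝ) ^ (-γ)) :
    ∃ fhat : ℕ → Ω → ℝ → ℝ,
      (∀ n : ℕ, 1 ≤ n → ∀ ω, 0 < σhat n ω →
        IsMTypeSpline m ρ (lam n) (σhat n ω) (t n)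
          (fun i : Fin n => f₀ (t n i) + ε i ω) (fhat n ω)) ∧
      IsBigOInProbability μ
        (fun n ω => sqNormSobolev m (lam n) (fun x => fhat n ω x - f₀ x))
        (fun n => lam n + ((n : ℝ) * lam n ^ (1 / (2 * (m : ℝ))))⁻¹) := by
  obtain ⟨B, hB⟩ := hψ₂_bdd
  have hρc : Continuous ρ := continuous_iff_continuousAt.2 fun x => (hψ x).continuousAt
  obtain ⟨⟨x₁, hx₁⟩, x₂, hx₂⟩ := exists_neg_and_pos (X := fun ω => ε 0 ω / σ)
    (hψ_sq.integrable (by norm_num)) hψ_mean hψ'_pos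
  obtain ⟨a, c, ha, hac⟩ := exists_mul_abs_sub_le hρ hψ hx₁ hx₂
  have hex : ∀ n ω, ∃ f : ℝ → ℝ, 1 ≤ n → 0 < σhat n ω →
      IsMTypeSpline m ρ (lam n) (σhat n ω) (t n) (fun i : Fin n => f₀ (t n i) + ε i ω) f := by
    intro n ω
    by_cases h : 1 ≤ n ∧ 0 < σhat n ω
    · obtain ⟨f, hf⟩ := exists_isMTypeSpline hm hρc ha hac (hlam_pos n) h.2 h.1 (ht n)
        (fun i : Fin n => f₀ (t n i) + ε i ω)
      exact ⟨f, fun _ _ => hf⟩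
    · exact ⟨0, fun h1 h2 => absurd ⟨h1, h2⟩ h⟩
  choose fhat hfhat using hex
  refine ⟨fhat, fun n hn ω hω => hfhat n ω hn hω, fun δ hδ => ?_⟩
  simp only [div_eq_inv_mul (ε 0 _) σ] at hψ_sq hψ_mean hψ'_pos hψ'ε_sq hψ'ε_mean
  -- The budget `δ` splits into six parts: five for the regular sample, one for the scale estimate.
  obtain ⟨b, hb, hreg⟩ := exists_measure_not_isRegularSample_le hε_meas hε_indep hε_ident hψ₁ hψ₂
    hB hψ_sq hψ_mean hψ'ε_sq hψ'ε_mean hε_sq (by positivity : 0 < δ / 6)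
  obtain ⟨T, hT, hscale⟩ := hσhat.exists_abs_inv_sub_inv_le hm hσ (by positivity : 0 < δ / 6)
  have hσ' : 0 < σ⁻¹ := inv_pos.2 hσ
  obtain ⟨D, η, hD, hη, hbound⟩ := exists_isMTypeSpline_bound hm hf₀ ht hρ hψ hψ₁ hψ₂ hB ht_unif
    hσ' hψ'_pos (κ' := ∫ ω, |ε 0 ω| ∂μ) (integral_nonneg fun _ => abs_nonneg _)
    (le_add_of_le_of_nonneg hb hT : 1 ≤ b + T)
  refine ⟨D ^ 2, ?_⟩
  obtain ⟨hlim₁, hlim₂⟩ := tendsto_bandwidth hm hlam_pos hγ hlam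
  have hη2 : 0 < η ^ 2 / 2 := by positivity
  filter_upwards [hscale (min η (σ⁻¹ / 2)) (lt_min hη (by positivity)),
    hlim₁.eventually (eventually_le_nhds one_pos), hlim₁.eventually (eventually_le_nhds hη2),
    hlim₂.eventually (eventually_le_nhds hη2), eventually_ge_atTop 2] with n hn₁ hh1 hhη hβη hn
  have hn0 : (0 : ℝ) < n := by exact_mod_cast (by omega : 0 < n)
  have hm0 : (0 : ℝ) < m := by exact_mod_cast hm
  have hh0 : 0 < lam n ^ (1 / (2 * (m : ℝ))) := Real.rpow_pos_of_pos (hlam_pos n) _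
  have hpow : (lam n ^ (1 / (2 * (m : ℝ)))) ^ (2 * m) = lam n := by
    rw [← Real.rpow_natCast, ← Real.rpow_mul (hlam_pos n).le]
    push_cast
    rw [one_div_mul_cancel (by positivity), Real.rpow_one]
  set h := lam n ^ (1 / (2 * (m : ℝ))) with hh
  have hr : (h ^ (2 * m) + ((n : ℝ) * h)⁻¹) / h ≤ η ^ 2 := by
    have h1 : h ^ (2 * m) ≤ h ^ 2 := pow_le_pow_of_le_one hh0.le hh1 (by omega)
    calc (h ^ (2 * m) + ((n : ℝ) * h)⁻¹) / h ≤ (h ^ 2 + ((n : ℝ) * h)⁻¹) / h := by gcongr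
      _ = h + ((n : ℝ) * h ^ 2)⁻¹ := by field_simp
      _ ≤ η ^ 2 := by linarith
  have hsub : {ω | D ^ 2 * |lam n + ((n : ℝ) * h)⁻¹| <
        |sqNormSobolev m (lam n) fun x => fhat n ω x - f₀ x|} ⊆
      {ω | ¬ IsRegularSample ψ σ⁻¹ (∫ ω, deriv ψ (σ⁻¹ * ε 0 ω) ∂μ) (∫ ω, |ε 0 ω| ∂μ) b h (t n)
        (fun i => ε i ω)} ∪
      {ω | ¬ (0 < σhat n ω ∧ |(σhat n ω)⁻¹ - σ⁻¹| ≤ min η (σ⁻¹ / 2) ∧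
        ((σhat n ω)⁻¹ - σ⁻¹) ^ 2 ≤ T * √((n : ℝ)⁻¹))} := by
    intro ω hω
    by_contra hcon
    simp only [mem_union, mem_ofPred_eq, not_or, not_not] at hcon
    obtain ⟨hs, hσ0, hσ1, hσ2⟩ := hcon
    have hs' : IsRegularSample ψ σ⁻¹ (∫ ω, deriv ψ (σ⁻¹ * ε 0 ω) ∂μ) (∫ ω, |ε 0 ω| ∂μ) (b + T) h
        (t n) (fun i => ε i ω) := hs.mono hh0.le (by linarith)
    have hf := hfhat n ω (by omega) hσ0
    rw [← hpow] at hf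
    have key := hbound n hn h hh0 hh1 (hβη.trans (by linarith)) hr _ hs' (σhat n ω)
      (hσ1.trans (min_le_left _ _)) (hσ1.trans (min_le_right _ _))
      (hσ2.trans (by gcongr; linarith)) _ hf
    rw [hpow] at key
    have hpos : 0 ≤ sqNormSobolev m (lam n) fun x => fhat n ω x - f₀ x :=
      add_nonneg (sqNormL2_nonneg _) (mul_nonneg (hlam_pos n).le (sqNormL2_nonneg _))
    have hpos' : 0 < lam n + ((n : ℝ) * h)⁻¹ := add_pos (hlam_pos n) (by positivity)
    have hω' : D ^ 2 * |lam n + ((n : ℝ) * h)⁻¹| <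
        |sqNormSobolev m (lam n) fun x => fhat n ω x - f₀ x| := hω
    rw [abs_of_nonneg hpos, abs_of_pos hpos'] at hω'
    linarith
  refine (measure_mono hsub).trans ((measure_union_le _ _).trans
    ((add_le_add (hreg n (by omega) h hh0 hh1 (t n) (ht n)) hn₁).trans (le_of_eq ?_)))
  have h6 : ENNReal.ofReal δ = 6 * ENNReal.ofReal (δ / 6) := by
    rw [← ENNReal.ofReal_ofNat, ← ENNReal.ofReal_mul (by norm_num)]
    congr 1; ring
  rw [h6]
  ring
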